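/- A partition of a natural number $n$ is a nonincreasing finite sequence of positive integers with sum $n$ (the empty partition being the only partition of $0$). A partition is a $3$-core if none of the hook numbers of its Young diagram is a multiple of $3$. Let $B_3(n)$ denote the number of partition triples of $n$ with $3$-cores, that is, of ordered triples $(\lambda_1,\lambda_2,\lambda_3)$ of partitions, each of which is a $3$-core, such that the sum of all the parts of $\lambda_1,\lambda_2,\lambda_3$ equals $n$. For $k\ge 1$ let $$f_k=\prod_{n=1}^{\infty}(1-q^{kn}),$$ regarded as a formal power series in $q$. Then, as identities of formal power series, $$\sum_{n=0}^{\infty}B_3(6n)q^n=\frac{f_2^{10}f_3^{9}}{f_1^{7}f_6^{6}}+16q\,\frac{f_2^{7}f_6^{3}}{f_1^{4}}+27q\,\frac{f_2^{2}f_3^{5}f_6^{2}}{f_1^{3}}$$ and $$\sum_{n=0}^{\infty}B_3(6n+4)q^n=24\,\frac{f_2^{8}f_3^{3}}{f_1^{5}}.$$ In particular, $B_3(6n+4)\equiv 0\pmod{24}$ for every integer $n\ge 0$. -/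

import Mathlib

open PowerSeries

/-- The Young diagram of a partition `p` of `n`: its rows have the parts of `p` as lengths, in
nonincreasing order. -/
def Nat.Partition.youngDiagram {n : ℕ} (p : n.Partition) : YoungDiagram :=
  YoungDiagram.ofRowLens (p.parts.sort (· ≥ ·)) (Multiset.pairwise_sort p.parts (· ≥ ·)).sortedGE

/-- The hook number of the cell `(i, j)` of a Young diagram (row `i`, column `j`, counted from `0`):
the number of cells to the right of it, plus the number of cells below it, plus one. -/
def YoungDiagram.hookNumber (μ : YoungDiagram) (i j : ℕ) : ℕ :=
  (μ.rowLen i - (j + 1)) + (μ.colLen j - (i + 1)) + 1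

/-- A partition is a `t`-core if none of its hook numbers is a multiple of `t`. -/
def Nat.Partition.IsCore {n : ℕ} (t : ℕ) (p : n.Partition) : Prop :=
  ∀ c ∈ p.youngDiagram.cells, ¬ t ∣ p.youngDiagram.hookNumber c.1 c.2

/-- The set of partition triples of `n` with `t`-cores: triples of partitions (of arbitrary natural
numbers, the empty partition of `0` included), each of them a `t`-core, of total size `n`. -/
def coreTriples (t n : ℕ) : Set (Fin 3 → Σ m : ℕ, m.Partition) :=
  {l | (∀ i, (l i).2.IsCore t) ∧ ∑ i, (l i).1 = n}

theorem finite_coreTriples (t n : ℕ) : (coreTriples t n).Finite := by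
  have hfin : (Set.univ.pi fun _ : Fin 3 =>
      Set.range (fun x : (Σ m : Fin (n + 1), (m : ℕ).Partition) =>
        (⟨x.1, x.2⟩ : Σ m : ℕ, m.Partition))).Finite :=
    Set.Finite.pi fun _ => Set.finite_range _
  refine hfin.subset ?_
  rintro l ⟨-, hl⟩ i -
  have hi : (l i).1 ≤ n := hl ▸ Finset.single_le_sum (f := fun i => (l i).1)
    (fun _ _ => Nat.zero_le _) (Finset.mem_univ i)
  exact ⟨⟨⟨(l i).1, Nat.lt_succ_of_le hi⟩, (l i).2⟩, rfl⟩

/-- `numCoreTriples t n` is the number of partition triples of `n` with `t`-cores. -/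
noncomputable def numCoreTriples (t n : ℕ) : ℕ := (coreTriples t n).ncard

open scoped PowerSeries.WithPiTopology in
/-- The infinite product `f_k = ∏_{n ≥ 1} (1 - q ^ (k n))`, as a formal power series in `q`
(the product converges coefficientwise, for every `k ≥ 1`). -/
noncomputable def eulerF (k : ℕ) : ℚ⟦X⟧ := ∏' n : ℕ, (1 - X ^ (k * (n + 1)))

open scoped PowerSeries.WithPiTopology in
theorem multipliable_eulerF {k : ℕ} (hk : 0 < k) :
    Multipliable fun n : ℕ => (1 - X ^ (k * (n + 1)) : ℚ⟦X⟧) := by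
  simp_rw [sub_eq_add_neg]
  apply PowerSeries.WithPiTopology.multipliable_one_add_of_tendsto_order_atTop_nhds_top
  simp_rw [order_neg, order_X_pow]
  refine ENat.tendsto_natCast_nhds_top.comp ?_
  exact Filter.tendsto_atTop_mono (fun n => (show n ≤ k * (n + 1) by nlinarith)) Filter.tendsto_id

open scoped PowerSeries.WithPiTopology in
/-- `f_k` has constant coefficient `1`, so that `(eulerF k)⁻¹` is a genuine inverse. -/
theorem constantCoeff_eulerF {k : ℕ} (hk : 0 < k) : constantCoeff (eulerF k) = 1 := by
  rw [eulerF, (multipliable_eulerF hk).map_tprod _ (PowerSeries.WithPiTopology.continuous_constantCoeff ℚ)]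
  simp [hk.ne']

/-! Write T for the generating function of 3-cores; the series of B₃ is T³. A partition is a 3-core
exactly when its set of first-column hook lengths is closed under subtracting 3. Such a set is two
initial segments, of the residue classes 1 and 2 mod 3, so 3-cores correspond to pairs (a, b) of
naturals and have size a² - ab + b² + b. Three such cones tile ℤ², which makes 3T a theta series of
the hexagonal lattice. Linear substitutions in ℤ³ and ℤ², together with Jacobi's triple product,
then give T = f₃³/f₁ (`powSum_coreSize_mul_eulerF`) and the 2-dissection T(q) = A(q²) + q T(q⁴),
where A = f₂³f₃²/(f₁²f₆) (`powSum_coreSize_eq`).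

Hence the even part of T³ is A³ + 3qA·T(q²)². Multiplied by φ(-q) = f₁²/f₂ it becomes (f₃⁶/f₆³)ψ(q)⁴
+ 3q f₃²f₆⁵, where ψ = f₂²/f₁. The theta functions have the 3-dissections φ(-q) = φ(-q⁹) - 2qΩ(q³)
and ψ(q) = P(q³) + qψ(q⁹) (`phiSeries_eq`, `psiSeries_eq`). Multiplying over the substitutions q ↦
ωʲq, with ω a primitive cube root of unity, gives φ(-q³)³ - 8qΩ(q)³ and P(q)³ + qψ(q³)³ as eta
quotients (`phi_cubic_relation`, `psi_cubic_relation`). The first rationalises 1/φ(-q), so every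
factor is 3-dissected. The parts with exponents 0 and 2 mod 3 are the two required series, up to
multiples of the second relation. The congruence follows because f₂⁸f₃³/f₁⁵ has integer
coefficients. -/

open scoped PowerSeries.WithPiTopology
open Filter Topology

/-! ### Gaussian binomials and the finite triple product. -/

/-- The product `∏_{t=1}^{k} (1 - Q ^ t)`. -/
noncomputable def qFactor {R : Type*} [CommRing R] (Q : R) (k : ℕ) : R :=
  ∏ t ∈ Finset.range k, (1 - Q ^ (t + 1))

/-- Gaussian binomial coefficients in `Q`. -/
noncomputable def gaussBinom {R : Type*} [CommRing R] (Q : R) : ℕ → ℕ → R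
  | _, 0 => 1
  | 0, _ + 1 => 0
  | N + 1, p + 1 => gaussBinom Q N (p + 1) + Q ^ (N - p) * gaussBinom Q N p

theorem gaussBinom_eq_zero {R : Type*} [CommRing R] (Q : R) :
    ∀ {N p : ℕ}, N < p → gaussBinom Q N p = 0
  | 0, p + 1, _ => by simp [gaussBinom]
  | N + 1, p + 1, h => by
    rw [gaussBinom, gaussBinom_eq_zero Q (by omega), gaussBinom_eq_zero Q (by omega)]
    simp

theorem gaussBinom_self {R : Type*} [CommRing R] (Q : R) (N : ℕ) : gaussBinom Q N N = 1 := by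
  induction N with
  | zero => simp [gaussBinom]
  | succ N ih => simp [gaussBinom, ih, gaussBinom_eq_zero]

/-- The quotient formula for Gaussian binomials, kept free of division so that it makes sense in any
commutative ring. The induction combines the cases (p + 1, r) and (p, r + 1) through the Pascal
rule. -/
theorem gaussBinom_mul_qFactor {R : Type*} [CommRing R] (Q : R) (p r : ℕ) :
    gaussBinom Q (p + r) p * (qFactor Q p * qFactor Q r) = qFactor Q (p + r) := by
  suffices H : ∀ N p r : ℕ, p + r = N →
      gaussBinom Q N p * (qFactor Q p * qFactor Q r) = qFactor Q N from H _ _ _ rfl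
  intro N
  induction N with
  | zero =>
    intro p r h
    obtain ⟨rfl, rfl⟩ : p = 0 ∧ r = 0 := by omega
    simp [gaussBinom, qFactor]
  | succ N ih =>
    intro p r h
    rcases p with _ | p
    · obtain rfl : r = N + 1 := by omega
      simp [gaussBinom, qFactor]
    rcases r with _ | r
    · obtain rfl : p = N := by omega
      rw [gaussBinom_self]
      simp [qFactor]
    have h1 := ih (p + 1) r (by omega)
    have h2 := ih p (r + 1) (by omega)
    have e1 : ∀ k, qFactor Q (k + 1) = qFactor Q k * (1 - Q ^ (k + 1)) := fun k => by
      simp [qFactor, Finset.prod_range_succ]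
    rw [gaussBinom, e1 N, e1 r]
    rw [e1 p] at h1 ⊢
    rw [e1 r] at h2
    obtain rfl : N = p + 1 + r := by omega
    have e2 : p + 1 + r - p = r + 1 := by omega
    rw [e2]
    linear_combination (1 - Q ^ (r + 1)) * h1 + Q ^ (r + 1) * (1 - Q ^ (p + 1)) * h2

/-- The `q`-binomial theorem. -/
theorem prod_add_mul_pow {R : Type*} [CommRing R] (Q x y : R) (N : ℕ) :
    ∏ k ∈ Finset.range N, (y + x * Q ^ k) =
      ∑ p ∈ Finset.range (N + 1), gaussBinom Q N p * Q ^ (p.choose 2) * x ^ p * y ^ (N - p) := by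
  induction N with
  | zero => simp [gaussBinom]
  | succ N ih =>
    rw [Finset.prod_range_succ, ih, Finset.sum_range_succ' _ (N + 1), mul_add]
    have h1 : ∀ p ∈ Finset.range (N + 1),
        gaussBinom Q (N + 1) (p + 1) * Q ^ ((p + 1).choose 2) * x ^ (p + 1) *
          y ^ (N + 1 - (p + 1)) =
        gaussBinom Q N (p + 1) * Q ^ ((p + 1).choose 2) * x ^ (p + 1) * y ^ (N - p) +
        gaussBinom Q N p * Q ^ (p.choose 2) * x ^ p * y ^ (N - p) * (x * Q ^ N) := by
      intro p hp
      have hp' : p ≤ N := by simpa [Nat.lt_succ_iff] using hp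
      have e : (p + 1).choose 2 = p + p.choose 2 := by
        rw [Nat.choose_succ_succ' p 1]; simp
      have e' : Q ^ (N - p) * Q ^ p = Q ^ N := by rw [← pow_add]; congr 1; omega
      rw [gaussBinom, Nat.add_sub_add_right, e, ← e']
      ring
    rw [Finset.sum_congr rfl h1, Finset.sum_add_distrib, ← Finset.sum_mul]
    have h2 : (∑ p ∈ Finset.range (N + 1),
        gaussBinom Q N p * Q ^ (p.choose 2) * x ^ p * y ^ (N - p)) * y =
        ∑ p ∈ Finset.range (N + 1),
          gaussBinom Q N (p + 1) * Q ^ ((p + 1).choose 2) * x ^ (p + 1) * y ^ (N - p) +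
        gaussBinom Q (N + 1) 0 * Q ^ (Nat.choose 0 2) * x ^ 0 * y ^ (N + 1 - 0) := by
      rw [Finset.sum_range_succ', Finset.sum_range_succ _ N,
        gaussBinom_eq_zero Q (Nat.lt_succ_self N), add_mul, Finset.sum_mul]
      have : ∀ p ∈ Finset.range N, gaussBinom Q N (p + 1) * Q ^ ((p + 1).choose 2) * x ^ (p + 1) *
          y ^ (N - (p + 1)) * y = gaussBinom Q N (p + 1) * Q ^ ((p + 1).choose 2) * x ^ (p + 1) *
          y ^ (N - p) := by
        intro p hp
        have hp' : p < N := by simpa using hp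
        obtain ⟨c, rfl⟩ := Nat.exists_eq_add_of_lt hp'
        have e1 : p + c + 1 - (p + 1) = c := by omega
        have e2 : p + c + 1 - p = c + 1 := by omega
        rw [e1, e2, pow_succ y]
        ring
      rw [Finset.sum_congr rfl this]
      simp [gaussBinom, pow_succ]
    rw [h2]
    ring

/-- In the first half of the product the factor a(ab)^k comes out and leaves 1 + b(ab)^(n-1-k); in
the second half (ab)^n comes out and leaves 1 + a(ab)^k. Taking y = (ab)^n in the q-binomial theorem
thus yields a two-sided product without negative powers. -/
theorem prod_range_two_mul_add_mul_pow {R : Type*} [CommRing R] (a b : R) (n : ℕ) :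
    ∏ k ∈ Finset.range (2 * n), ((a * b) ^ n + a * (a * b) ^ k) =
      a ^ n * (a * b) ^ (n.choose 2 + n * n) *
        ∏ k ∈ Finset.range n, ((1 + a * (a * b) ^ k) * (1 + b * (a * b) ^ k)) := by
  rw [two_mul, Finset.prod_range_add]
  have h1 : ∀ k ∈ Finset.range n, (a * b) ^ n + a * (a * b) ^ k =
      a * (a * b) ^ k * (1 + b * (a * b) ^ (n - 1 - k)) := by
    intro k hk
    have hk' : k < n := by simpa using hk
    have : (a * b) ^ n = (a * b) ^ k * (a * b) ^ (n - 1 - k) * (a * b) := by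
      rw [← pow_add, ← pow_succ]; congr 1; omega
    rw [this]; ring
  have h2 : ∀ k ∈ Finset.range n, (a * b) ^ n + a * (a * b) ^ (n + k) =
      (a * b) ^ n * (1 + a * (a * b) ^ k) := fun k _ => by ring
  rw [Finset.prod_congr rfl h1, Finset.prod_congr rfl h2, Finset.prod_mul_distrib,
    Finset.prod_mul_distrib, Finset.prod_mul_distrib, Finset.prod_mul_distrib,
    Finset.prod_const, Finset.prod_const, Finset.card_range, Finset.prod_pow_eq_pow_sum,
    Finset.sum_range_id, ← Nat.choose_two_right,
    Finset.prod_range_reflect (fun k => 1 + b * (a * b) ^ k) n]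
  ring

theorem two_mul_choose_two (n : ℕ) : 2 * (n.choose 2 : ℤ) = n * (n - 1) := by
  induction n with
  | zero => simp
  | succ n ih =>
    rw [Nat.choose_succ_succ' n 1, Nat.choose_one_right]
    push_cast
    linarith

/-! ### Theta series and Jacobi's triple product. -/

/-- The triangular number `l (l + 1) / 2`, for an integer `l`. -/
def triangular (l : ℤ) : ℕ := (l * (l + 1) / 2).toNat

theorem two_mul_triangular (l : ℤ) : 2 * (triangular l : ℤ) = l * (l + 1) := by
  have h0 : 0 ≤ l * (l + 1) := by
    rcases le_or_gt 0 l with h | h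
    · positivity
    · nlinarith
  have h2 : 2 * (l * (l + 1) / 2) = l * (l + 1) :=
    Int.mul_ediv_cancel' (Int.even_mul_succ_self l).two_dvd
  rw [triangular, Int.toNat_of_nonneg (by omega), h2]

theorem triangular_neg_one_sub (l : ℤ) : triangular (-1 - l) = triangular l := by
  have h1 := two_mul_triangular l
  have h2 := two_mul_triangular (-1 - l)
  zify
  linarith

/-- The general term of the theta series occurring in Jacobi's triple product identity. -/
noncomputable def thetaTerm (ε : ℤˣ) (i j : ℕ) (l : ℤ) : ℚ⟦X⟧ :=
  (((ε ^ l : ℤˣ) : ℤ) : ℚ⟦X⟧) * X ^ (i * triangular l + j * triangular (l - 1))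

/-- The two triangular numbers add up to l², which is at least |l|. This linear bound gives
summability and controls the tails in the limit. -/
theorem natAbs_le_theta_exponent {i j : ℕ} (hi : 0 < i) (hj : 0 < j) (l : ℤ) :
    l.natAbs ≤ i * triangular l + j * triangular (l - 1) := by
  have h1 := two_mul_triangular l
  have h2 := two_mul_triangular (l - 1)
  have h3 : l.natAbs ≤ triangular l + triangular (l - 1) := by
    have h4 : (l.natAbs : ℤ) * l.natAbs = l * l := Int.natAbs_mul_self' l
    have h5 : (l.natAbs : ℤ) ≤ l.natAbs * l.natAbs := by
      exact_mod_cast Nat.le_mul_self _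
    zify at *
    linarith
  nlinarith

/-- The q-binomial theorem with a = εX^i and b = εX^j, where ε² = 1 makes ab a pure power of X. The
monomial produced by the folding of the product is nonzero and is cancelled; recentring at p = n
turns the exponents into theta exponents. -/
theorem prod_range_eq_sum_thetaTerm (ε : ℤˣ) (i j n : ℕ) :
    ∏ k ∈ Finset.range n, ((1 + ((ε : ℤ) : ℚ⟦X⟧) * X ^ (i + (i + j) * k)) *
        (1 + ((ε : ℤ) : ℚ⟦X⟧) * X ^ (j + (i + j) * k))) =
      ∑ p ∈ Finset.range (2 * n + 1),
        gaussBinom (X ^ (i + j) : ℚ⟦X⟧) (2 * n) p * thetaTerm ε i j (p - n) := by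
  set e : ℚ⟦X⟧ := ((ε : ℤ) : ℚ⟦X⟧) with he
  have he2 : e * e = 1 := by
    rw [he, ← Int.cast_mul]
    norm_cast
    simp
  set a : ℚ⟦X⟧ := e * X ^ i with ha
  set b : ℚ⟦X⟧ := e * X ^ j with hb
  have hab : a * b = X ^ (i + j) := by
    rw [ha, hb, pow_add]; linear_combination (X ^ i * X ^ j) * he2
  have hne : a ^ n * (a * b) ^ (n.choose 2 + n * n) ≠ 0 := by
    have he0 : e ≠ 0 := fun h => by simp [h] at he2
    rw [hab]
    exact mul_ne_zero (pow_ne_zero _ (mul_ne_zero he0 (pow_ne_zero _ X_ne_zero)))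
      (pow_ne_zero _ (pow_ne_zero _ X_ne_zero))
  apply mul_left_cancel₀ hne
  have h1 : ∀ k : ℕ, ((1 + e * X ^ (i + (i + j) * k)) * (1 + e * X ^ (j + (i + j) * k))) =
      (1 + a * (a * b) ^ k) * (1 + b * (a * b) ^ k) := fun k => by
    rw [hab, ha, hb, ← pow_mul, pow_add, pow_add]; ring
  simp_rw [h1]
  rw [← prod_range_two_mul_add_mul_pow, prod_add_mul_pow, Finset.mul_sum]
  refine Finset.sum_congr rfl fun p hp => ?_
  obtain ⟨r, hr⟩ : ∃ r, 2 * n = p + r := ⟨2 * n - p, by simp at hp; omega⟩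
  have hs : (e : ℚ⟦X⟧) ^ p = e ^ n * (((ε ^ ((p : ℤ) - n) : ℤˣ) : ℤ) : ℚ⟦X⟧) := by
    rw [he, ← Int.cast_pow, ← Int.cast_pow, ← Int.cast_mul]
    congr 1
    rw [← Units.val_pow_eq_pow_val, ← Units.val_pow_eq_pow_val, ← Units.val_mul]
    congr 1
    rw [← zpow_natCast, ← zpow_natCast, ← zpow_add]
    congr 1
    ring
  rw [hab, thetaTerm, ha, mul_pow, mul_pow, hs]
  have hexp : (i + j) * p.choose 2 + i * p + (i + j) * (n * (2 * n - p)) =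
      i * n + (i + j) * (n.choose 2 + n * n) +
        (i * triangular (p - n) + j * triangular (p - n - 1)) := by
    have t1 := two_mul_triangular ((p : ℤ) - n)
    have t2 := two_mul_triangular ((p : ℤ) - n - 1)
    have c1 := two_mul_choose_two p
    have c2 := two_mul_choose_two n
    have e : 2 * n - p = r := by omega
    rw [e]
    zify at hr ⊢
    have hr' : (r : ℤ) = 2 * n - p := by linarith
    rw [hr']
    apply mul_left_cancel₀ (two_ne_zero (α := ℤ))
    linear_combination ((i : ℤ) + j) * c1 - i * t1 - j * t2 - ((i : ℤ) + j) * c2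
  have hX : (X ^ (i + j) : ℚ⟦X⟧) ^ p.choose 2 * (X ^ i) ^ p * ((X ^ (i + j)) ^ n) ^ (2 * n - p) =
      (X ^ i) ^ n * (X ^ (i + j)) ^ (n.choose 2 + n * n) *
        X ^ (i * triangular (p - n) + j * triangular (p - n - 1)) := by
    simp only [← pow_mul, ← pow_add]
    congr 1
    rw [← hexp]; ring
  linear_combination (gaussBinom (X ^ (i + j) : ℚ⟦X⟧) (2 * n) p * e ^ n *
    (((ε ^ ((p : ℤ) - n) : ℤˣ) : ℤ) : ℚ⟦X⟧)) * hX

theorem summable_mul_X_pow {ι : Type*} (w : ι → ℚ⟦X⟧) (e : ι → ℕ)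
    (h : ∀ d, {i | e i ≤ d}.Finite) : Summable fun i => w i * X ^ e i := by
  rw [PowerSeries.WithPiTopology.summable_iff_summable_coeff]
  intro d
  apply summable_of_hasFiniteSupport
  refine (h d).subset fun i hi => ?_
  by_contra hlt
  exact hi ((coeff_mul_X_pow' _ _ _).trans (if_neg hlt))

theorem finite_setOf_natAbs_le (d : ℕ) : {l : ℤ | l.natAbs ≤ d}.Finite :=
  (Set.finite_Icc (-d : ℤ) d).subset fun l hl => by
    simp only [Set.mem_ofPred_eq] at hl
    simp only [Set.mem_Icc]
    omega

theorem finite_theta_exponent_le {i j : ℕ} (hi : 0 < i) (hj : 0 < j) (d : ℕ) :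
    {l : ℤ | i * triangular l + j * triangular (l - 1) ≤ d}.Finite :=
  (finite_setOf_natAbs_le d).subset fun l hl => (natAbs_le_theta_exponent hi hj l).trans hl

theorem summable_thetaTerm (ε : ℤˣ) {i j : ℕ} (hi : 0 < i) (hj : 0 < j) :
    Summable (thetaTerm ε i j) :=
  summable_mul_X_pow _ _ (finite_theta_exponent_le hi hj)

theorem X_pow_dvd_qFactor_sub (s k K d : ℕ) (hs : 0 < s) (hd : d ≤ k) (hK : k ≤ K) :
    (X ^ d : ℚ⟦X⟧) ∣ qFactor (X ^ s) K - qFactor (X ^ s) k := by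
  induction K, hK using Nat.le_induction with
  | base => simp
  | succ K hK ih =>
    have : qFactor (X ^ s : ℚ⟦X⟧) (K + 1) - qFactor (X ^ s) k =
        (qFactor (X ^ s) K - qFactor (X ^ s) k) - X ^ (s * (K + 1)) * qFactor (X ^ s) K := by
      rw [qFactor, Finset.prod_range_succ, ← qFactor, ← pow_mul]; ring
    rw [this]
    exact dvd_sub ih (Dvd.dvd.mul_right (pow_dvd_pow _ (by nlinarith)) _)

theorem tendsto_qFactor {s : ℕ} (hs : 0 < s) :
    Tendsto (qFactor (X ^ s : ℚ⟦X⟧)) atTop (𝓝 (eulerF s)) := by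
  have h := (multipliable_eulerF hs).hasProd.tendsto_prod_nat
  rw [eulerF]
  refine h.congr fun n => ?_
  simp [qFactor, pow_mul]

theorem X_pow_dvd_of_tendsto {f : ℕ → ℚ⟦X⟧} {a b : ℚ⟦X⟧} {d N : ℕ} (h : Tendsto f atTop (𝓝 a))
    (hf : ∀ n, N ≤ n → X ^ d ∣ f n - b) : X ^ d ∣ a - b := by
  rw [X_pow_dvd_iff]
  intro m hm
  have h1 := (PowerSeries.WithPiTopology.tendsto_iff_coeff_tendsto _ _ _ _).1 h m
  have h2 : Tendsto (fun n => coeff m (f n)) atTop (𝓝 (coeff m b)) := by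
    refine tendsto_const_nhds.congr' ?_
    filter_upwards [eventually_ge_atTop N] with n hn
    have := X_pow_dvd_iff.1 (hf n hn) m hm
    rw [map_sub, sub_eq_zero] at this
    exact this.symm
  rw [map_sub, tendsto_nhds_unique h1 h2, sub_self]

theorem X_pow_dvd_eulerF_sub {s k d : ℕ} (hs : 0 < s) (hd : d ≤ k) :
    (X ^ d : ℚ⟦X⟧) ∣ eulerF s - qFactor (X ^ s) k :=
  X_pow_dvd_of_tendsto (N := k) (tendsto_qFactor hs) fun n hn =>
    X_pow_dvd_qFactor_sub s k n d hs hd hn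

theorem isUnit_eulerF {k : ℕ} (hk : 0 < k) : IsUnit (eulerF k) := by
  rw [PowerSeries.isUnit_iff_constantCoeff, constantCoeff_eulerF hk]
  exact isUnit_one

/-- Modulo X^d the three finite products in the quotient formula all agree with the Euler product E,
so E²G ≡ E for the binomial G, and E is a unit. -/
theorem X_pow_dvd_eulerF_mul_gaussBinom_sub_one {s p r d : ℕ} (hs : 0 < s) (hp : d ≤ p)
    (hr : d ≤ r) : (X ^ d : ℚ⟦X⟧) ∣ eulerF s * gaussBinom (X ^ s) (p + r) p - 1 := by
  obtain ⟨u, hu⟩ := X_pow_dvd_eulerF_sub (k := p) hs hp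
  obtain ⟨v, hv⟩ := X_pow_dvd_eulerF_sub (k := r) hs hr
  obtain ⟨w, hw⟩ := X_pow_dvd_eulerF_sub (k := p + r) (d := d) hs (by omega)
  have h := gaussBinom_mul_qFactor (X ^ s : ℚ⟦X⟧) p r
  rw [← (isUnit_eulerF hs).dvd_mul_left]
  set E := eulerF s
  set G := gaussBinom (X ^ s : ℚ⟦X⟧) (p + r) p
  refine ⟨G * E * u + G * (E - X ^ d * u) * v - w, ?_⟩
  have h1 : qFactor (X ^ s : ℚ⟦X⟧) p = E - X ^ d * u := by linear_combination -hu
  have h2 : qFactor (X ^ s : ℚ⟦X⟧) r = E - X ^ d * v := by linear_combination -hv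
  have h3 : qFactor (X ^ s : ℚ⟦X⟧) (p + r) = E - X ^ d * w := by linear_combination -hw
  rw [h1, h2, h3] at h
  linear_combination h

theorem X_pow_dvd_eulerF_mul_prod_sub (ε : ℤˣ) {i j d n : ℕ} (hi : 0 < i) (hj : 0 < j)
    (hn : 2 * d ≤ n) :
    (X ^ d : ℚ⟦X⟧) ∣ eulerF (i + j) * ∏ k ∈ Finset.range n,
      ((1 + ((ε : ℤ) : ℚ⟦X⟧) * X ^ (i + (i + j) * k)) *
        (1 + ((ε : ℤ) : ℚ⟦X⟧) * X ^ (j + (i + j) * k))) -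
      ∑ p ∈ Finset.range (2 * n + 1), thetaTerm ε i j (p - n) := by
  rw [prod_range_eq_sum_thetaTerm, Finset.mul_sum, ← Finset.sum_sub_distrib]
  refine Finset.dvd_sum fun p hp => ?_
  have e : eulerF (i + j) * (gaussBinom (X ^ (i + j)) (2 * n) p * thetaTerm ε i j (p - n)) -
      thetaTerm ε i j (p - n) =
      (eulerF (i + j) * gaussBinom (X ^ (i + j)) (2 * n) p - 1) * thetaTerm ε i j (p - n) := by
    ring
  rw [e]
  obtain ⟨r, hr⟩ : ∃ r, 2 * n = p + r := ⟨2 * n - p, by simp at hp; omega⟩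
  by_cases hd : d ≤ p ∧ d ≤ r
  · rw [hr]
    exact (X_pow_dvd_eulerF_mul_gaussBinom_sub_one (by omega) hd.1 hd.2).mul_right _
  -- Near either end, |p - n| ≥ d because n ≥ 2d, so the theta term alone is divisible by X^d.
  · refine Dvd.dvd.mul_left (Dvd.dvd.mul_left (pow_dvd_pow _ ?_) _) _
    refine le_trans ?_ (natAbs_le_theta_exponent hi hj _)
    omega

theorem multipliable_one_add_mul_X_pow (ε : ℤˣ) {s : ℕ} (i : ℕ) (hs : 0 < s) :
    Multipliable fun k : ℕ => (1 + ((ε : ℤ) : ℚ⟦X⟧) * X ^ (i + s * k)) := by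
  apply PowerSeries.WithPiTopology.multipliable_one_add_of_tendsto_order_atTop_nhds_top
  have h : Tendsto (fun k : ℕ => ((i + s * k : ℕ) : ℕ∞)) atTop (𝓝 ⊤) :=
    ENat.tendsto_natCast_nhds_top.comp
      (tendsto_atTop_mono (fun n => (show n ≤ i + s * n by nlinarith)) tendsto_id)
  refine tendsto_nhds_top_mono h (Eventually.of_forall fun k => ?_)
  refine le_trans ?_ (le_order_mul _ _)
  simp

/-- The product `∏_{k ≥ 0} (1 + ε X ^ (i + s k))`. -/
noncomputable def signedProd (ε : ℤˣ) (i s : ℕ) : ℚ⟦X⟧ :=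
  ∏' k : ℕ, (1 + ((ε : ℤ) : ℚ⟦X⟧) * X ^ (i + s * k))

/-- **Jacobi's triple product identity**. -/
theorem tsum_thetaTerm (ε : ℤˣ) {i j : ℕ} (hi : 0 < i) (hj : 0 < j) :
    ∑' l, thetaTerm ε i j l =
      eulerF (i + j) * (signedProd ε i (i + j) * signedProd ε j (i + j)) := by
  have hs : 0 < i + j := by omega
  have m1 := multipliable_one_add_mul_X_pow ε i hs
  have m2 := multipliable_one_add_mul_X_pow ε j hs
  have hP := ((m1.hasProd.mul m2.hasProd).tendsto_prod_nat).const_mul (eulerF (i + j))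
  have hS : Tendsto (fun n : ℕ => ∑ p ∈ Finset.range (2 * n + 1), thetaTerm ε i j (p - n)) atTop
      (𝓝 (∑' l, thetaTerm ε i j l)) := by
    have h1 : Tendsto (fun n : ℕ => Finset.Icc (-n : ℤ) n) atTop atTop := by
      refine tendsto_atTop_finset_of_monotone (fun a b hab => ?_) fun x => ⟨x.natAbs, ?_⟩
      · exact Finset.Icc_subset_Icc (by simpa using hab) (by simpa using hab)
      · simp only [Finset.mem_Icc]; omega
    refine ((summable_thetaTerm ε hi hj).hasSum.comp h1).congr fun n => ?_
    symm
    refine Finset.sum_bij (fun p _ => (p : ℤ) - n) ?_ ?_ ?_ fun _ _ => rfl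
    · intro p hp; simp at hp ⊢; omega
    · intro p _ q _ h; simpa using h
    · intro l hl
      simp only [Finset.mem_Icc] at hl
      exact ⟨(l + n).toNat, by simp; omega, by omega⟩
  rw [signedProd, signedProd]
  ext d
  have c1 := (PowerSeries.WithPiTopology.tendsto_iff_coeff_tendsto _ _ _ _).1 hP d
  have c2 := (PowerSeries.WithPiTopology.tendsto_iff_coeff_tendsto _ _ _ _).1 hS d
  refine tendsto_nhds_unique (c2.congr' ?_) c1
  filter_upwards [eventually_ge_atTop (2 * (d + 1))] with n hn
  have := X_pow_dvd_iff.1 (X_pow_dvd_eulerF_mul_prod_sub ε hi hj hn) d (Nat.lt_succ_self d)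
  rw [map_sub, sub_eq_zero] at this
  exact this.symm

/-! ### Euler-product formulas for the four theta series. -/

theorem prod_range_mul_eq_prod_prod {M : Type*} [CommMonoid M] (g : ℕ → M) (m n : ℕ) :
    ∏ k ∈ Finset.range (m * n), g k =
      ∏ k ∈ Finset.range n, ∏ r ∈ Finset.range m, g (m * k + r) := by
  induction n with
  | zero => simp
  | succ n ih => rw [mul_add, mul_one, Finset.prod_range_add, ih, Finset.prod_range_succ]

/-- Sorts the factors by the residue of their index mod m. With the rule (1 + y)(1 - y) = 1 - y²,
this turns every triple product needed here into a quotient of Euler products. -/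
theorem signedProd_split (ε : ℤˣ) (i : ℕ) {s m : ℕ} (hs : 0 < s) (hm : 0 < m) :
    signedProd ε i s = ∏ r ∈ Finset.range m, signedProd ε (i + s * r) (s * m) := by
  have h1 := (multipliable_one_add_mul_X_pow ε i hs).hasProd.tendsto_prod_nat
  have h2 : Tendsto (fun n : ℕ => m * n) atTop atTop :=
    tendsto_id.const_mul_atTop' hm
  have h3 := h1.comp h2
  have h4 := (hasProd_prod (s := Finset.range m) fun r _ =>
    (multipliable_one_add_mul_X_pow ε (i + s * r) (Nat.mul_pos hs hm)).hasProd).tendsto_prod_nat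
  refine tendsto_nhds_unique h3 (h4.congr fun n => ?_)
  rw [Function.comp_apply, prod_range_mul_eq_prod_prod]
  refine Finset.prod_congr rfl fun k _ => Finset.prod_congr rfl fun r _ => ?_
  congr 3
  ring

theorem signedProd_neg_one_self (k : ℕ) : signedProd (-1) k k = eulerF k := by
  simp only [signedProd, eulerF]
  congr 1
  ext1 n
  rw [mul_add, mul_one, add_comm (k * n)]
  simp [sub_eq_add_neg]

theorem signedProd_one_mul_neg_one (i : ℕ) {s : ℕ} (hs : 0 < s) :
    signedProd 1 i s * signedProd (-1) i s = signedProd (-1) (2 * i) (2 * s) := by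
  rw [signedProd, signedProd, signedProd,
    ← (multipliable_one_add_mul_X_pow 1 i hs).tprod_mul (multipliable_one_add_mul_X_pow (-1) i hs)]
  congr 1
  ext1 n
  have : 2 * i + 2 * s * n = (i + s * n) + (i + s * n) := by ring
  rw [this, pow_add]
  simp
  ring

/-- `∑ (-1)^n q^(n²)`. -/
noncomputable def phiSeries : ℚ⟦X⟧ := ∑' l, thetaTerm (-1) 1 1 l

/-- `∑ q^(2n²+n)`, over all integers `n`. -/
noncomputable def psiSeries : ℚ⟦X⟧ := ∑' l, thetaTerm 1 3 1 l

/-- `∑ q^(n(3n+1)/2)`, over all integers `n`. -/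
noncomputable def pentSeries : ℚ⟦X⟧ := ∑' l, thetaTerm 1 2 1 l

/-- `∑ (-1)^n q^(3n²+2n)`, over all integers `n`. -/
noncomputable def omegaSeries : ℚ⟦X⟧ := ∑' l, thetaTerm (-1) 5 1 l

theorem phiSeries_mul : phiSeries * eulerF 2 = eulerF 1 ^ 2 := by
  have h := signedProd_split (-1) 1 (s := 1) (m := 2) one_pos two_pos
  simp only [Finset.prod_range_succ, Finset.range_zero, Finset.prod_empty, one_mul,
    add_zero, Nat.reduceAdd, signedProd_neg_one_self] at h
  rw [phiSeries, tsum_thetaTerm _ one_pos one_pos, h]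
  ring_nf

theorem psiSeries_mul : psiSeries * eulerF 1 = eulerF 2 ^ 2 := by
  have h := signedProd_split (-1) 1 (s := 1) (m := 2) one_pos two_pos
  have h' := signedProd_split (-1) 2 (s := 2) (m := 2) two_pos two_pos
  have h1 := signedProd_split 1 1 (s := 2) (m := 2) two_pos two_pos
  have h2 := signedProd_one_mul_neg_one 1 (s := 2) two_pos
  simp only [Finset.prod_range_succ, Finset.range_zero, Finset.prod_empty, one_mul, mul_zero,
    add_zero, mul_one, Nat.reduceAdd, Nat.reduceMul, signedProd_neg_one_self] at h h' h1 h2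
  rw [psiSeries, tsum_thetaTerm _ three_pos one_pos, h]
  linear_combination -eulerF 4 * eulerF 2 * signedProd (-1) 1 2 * h1 + eulerF 4 * eulerF 2 * h2 -
    eulerF 2 * h'

theorem pentSeries_mul : pentSeries * (eulerF 1 * eulerF 6) = eulerF 2 * eulerF 3 ^ 2 := by
  have h1 := signedProd_split 1 1 (s := 1) (m := 3) one_pos three_pos
  have h2 := signedProd_one_mul_neg_one 1 (s := 1) one_pos
  have h3 := signedProd_one_mul_neg_one 3 (s := 3) three_pos
  simp only [Finset.prod_range_succ, Finset.range_zero, Finset.prod_empty, one_mul,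
    add_zero, mul_one, Nat.reduceAdd, Nat.reduceMul, signedProd_neg_one_self] at h1 h2 h3
  rw [pentSeries, tsum_thetaTerm _ two_pos one_pos, ← h3, ← h2, h1]
  ring_nf

theorem omegaSeries_mul : omegaSeries * (eulerF 2 * eulerF 3) = eulerF 1 * eulerF 6 ^ 2 := by
  have h1 := signedProd_split (-1) 1 (s := 1) (m := 6) one_pos (by norm_num)
  have h2 := signedProd_split (-1) 2 (s := 2) (m := 3) two_pos (by norm_num)
  have h3 := signedProd_split (-1) 3 (s := 3) (m := 2) three_pos (by norm_num)
  simp only [Finset.prod_range_succ, Finset.range_zero, Finset.prod_empty, one_mul, mul_zero,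
    add_zero, mul_one, Nat.reduceAdd, Nat.reduceMul, signedProd_neg_one_self] at h1 h2 h3
  rw [omegaSeries, tsum_thetaTerm _ (by norm_num) one_pos, h1, h2, h3]
  ring_nf

/-! ### Substitution X ↦ X^m and the norm over cube roots of unity. -/

theorem continuous_expand {m : ℕ} (hm : m ≠ 0) :
    Continuous (expand m hm : ℚ⟦X⟧ → ℚ⟦X⟧) := by
  rw [continuous_iff_continuousAt]
  intro f
  rw [ContinuousAt, PowerSeries.WithPiTopology.tendsto_iff_coeff_tendsto]
  intro d
  simp only [coeff_expand]
  split_ifs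
  · exact (PowerSeries.WithPiTopology.continuous_coeff ℚ _).tendsto f
  · exact tendsto_const_nhds

theorem expand_injective {m : ℕ} (hm : m ≠ 0) :
    Function.Injective (expand m hm : ℚ⟦X⟧ → ℚ⟦X⟧) := by
  intro f g h
  ext n
  rw [← coeff_expand_mul m hm f, h, coeff_expand_mul]

theorem expand_eulerF {m : ℕ} (hm : m ≠ 0) {k : ℕ} (hk : 0 < k) :
    expand m hm (eulerF k) = eulerF (m * k) := by
  rw [eulerF, (multipliable_eulerF hk).map_tprod _ (continuous_expand hm), eulerF]
  congr 1
  ext1 n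
  rw [map_sub, map_one, map_pow, expand_X, ← pow_mul, mul_assoc]

section Norm

variable (ω : ℂ)

/-- The inclusion of rational power series into complex ones. -/
noncomputable def complexify : ℚ⟦X⟧ →+* ℂ⟦X⟧ := PowerSeries.map (algebraMap ℚ ℂ)

theorem complexify_injective : Function.Injective complexify :=
  PowerSeries.map_injective _ (algebraMap ℚ ℂ).injective

/-- The product of the images of `f` under `X ↦ X`, `X ↦ ω X` and `X ↦ ω² X`. -/
noncomputable def cubicNorm : ℚ⟦X⟧ →* ℂ⟦X⟧ where
  toFun f := complexify f * rescale ω (complexify f) * rescale (ω ^ 2) (complexify f)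
  map_one' := by simp
  map_mul' f g := by simp only [map_mul]; ring

theorem cubicNorm_apply (f : ℚ⟦X⟧) : cubicNorm ω f =
    complexify f * rescale ω (complexify f) * rescale (ω ^ 2) (complexify f) := rfl

theorem continuous_rescale (a : ℂ) : Continuous (rescale a : ℂ⟦X⟧ → ℂ⟦X⟧) := by
  rw [continuous_iff_continuousAt]
  intro f
  rw [ContinuousAt, PowerSeries.WithPiTopology.tendsto_iff_coeff_tendsto]
  intro d
  simp only [coeff_rescale]
  exact ((PowerSeries.WithPiTopology.continuous_coeff ℂ d).tendsto f).const_mul _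

theorem continuous_complexify : Continuous complexify := by
  rw [continuous_iff_continuousAt]
  intro f
  rw [ContinuousAt, PowerSeries.WithPiTopology.tendsto_iff_coeff_tendsto]
  intro d
  simp only [complexify, coeff_map]
  exact ((continuous_algebraMap ℚ ℂ).tendsto _).comp
    ((PowerSeries.WithPiTopology.continuous_coeff ℚ d).tendsto f)

theorem continuous_cubicNorm : Continuous (cubicNorm ω) :=
  (continuous_complexify.mul ((continuous_rescale _).comp continuous_complexify)).mul
    ((continuous_rescale _).comp continuous_complexify)

variable {ω}

theorem rescale_complexify_expand (hω : ω ^ 3 = 1) (f : ℚ⟦X⟧) :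
    rescale ω (complexify (expand 3 three_ne_zero f)) =
      complexify (expand 3 three_ne_zero f) := by
  ext n
  rw [coeff_rescale, complexify, coeff_map, coeff_expand]
  split_ifs with h
  · obtain ⟨k, rfl⟩ := h
    rw [pow_mul, hω, one_pow, one_mul]
  · simp

/-- Series in X³ are fixed by X ↦ ωX, so the norm is (a + Xb)(a + ωXb)(a + ω²Xb) = a³ + X³b³, again
a series in X³. -/
theorem cubicNorm_add_X_mul (hω : ω ^ 2 + ω + 1 = 0) (f g : ℚ⟦X⟧) :
    cubicNorm ω (expand 3 three_ne_zero f + X * expand 3 three_ne_zero g) =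
      complexify (expand 3 three_ne_zero (f ^ 3 + X * g ^ 3)) := by
  have h3 : ω ^ 3 = 1 := by linear_combination (ω - 1) * hω
  have h3' : (ω ^ 2) ^ 3 = 1 := by linear_combination (ω ^ 3 + 1) * h3
  have hX : complexify X = X := by simp [complexify]
  have hC : (C ω : ℂ⟦X⟧) ^ 2 + C ω + 1 = 0 := by
    rw [← map_pow, ← map_one (C (R := ℂ)), ← map_add, ← map_add, hω, map_zero]
  simp only [cubicNorm_apply, map_add, map_mul, rescale_complexify_expand h3,
    rescale_complexify_expand h3', hX, rescale_X, map_pow, expand_X]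
  set a := complexify (expand 3 three_ne_zero f)
  set b := complexify (expand 3 three_ne_zero g)
  set w : ℂ⟦X⟧ := C ω
  linear_combination (a ^ 2 * X * b + a * X ^ 2 * b ^ 2 * w + X ^ 3 * b ^ 3 * (w - 1)) * hC

end Norm

section Norm

variable {ω : ℂ}

theorem multipliable_neg_one (i : ℕ) {s : ℕ} (hs : 0 < s) :
    Multipliable fun k : ℕ => (1 - X ^ (i + s * k) : ℚ⟦X⟧) := by
  simpa [sub_eq_add_neg] using multipliable_one_add_mul_X_pow (-1) i hs

theorem signedProd_neg_one (i s : ℕ) :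
    signedProd (-1) i s = ∏' k : ℕ, (1 - X ^ (i + s * k) : ℚ⟦X⟧) := by
  simp [signedProd, sub_eq_add_neg]

theorem cubicNorm_one_sub_X_pow_of_dvd (hω : ω ^ 2 + ω + 1 = 0) {n : ℕ} (hn : 3 ∣ n) :
    cubicNorm ω (1 - X ^ n) = complexify ((1 - X ^ n) ^ 3) := by
  obtain ⟨n, rfl⟩ := hn
  have h := cubicNorm_add_X_mul hω (1 - X ^ n) 0
  simpa [expand_X, ← pow_mul] using h

/-- Here ω^n is again a primitive cube root of unity, and the product of 1 - w^j x over j = 0, 1, 2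
is 1 - x³. -/
theorem cubicNorm_one_sub_X_pow_of_not_dvd (hω : ω ^ 2 + ω + 1 = 0) {n : ℕ} (hn : ¬ 3 ∣ n) :
    cubicNorm ω (1 - X ^ n) = complexify (1 - X ^ (3 * n)) := by
  have h3 : ω ^ 3 = 1 := by linear_combination (ω - 1) * hω
  have hX : complexify X = X := by simp [complexify]
  have hC : (C ω : ℂ⟦X⟧) ^ 2 + C ω + 1 = 0 := by
    rw [← map_pow, ← map_one (C (R := ℂ)), ← map_add, ← map_add, hω, map_zero]
  have hC3 : (C ω : ℂ⟦X⟧) ^ 3 = 1 := by linear_combination (C ω - 1) * hC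
  have hn' : ((C ω : ℂ⟦X⟧) ^ n) ^ 2 + C ω ^ n + 1 = 0 := by
    have h := Nat.div_add_mod n 3
    have h1 : (C ω : ℂ⟦X⟧) ^ n = C ω ^ (n % 3) := by
      conv_lhs => rw [← h, pow_add, pow_mul, hC3, one_pow, one_mul]
    rw [h1]
    obtain h2 | h2 : n % 3 = 1 ∨ n % 3 = 2 := by omega
    · rw [h2]; linear_combination hC
    · rw [h2]; linear_combination hC + C ω * hC3
  simp only [cubicNorm_apply, map_sub, map_pow, map_one, hX, rescale_X]
  rw [pow_mul' X 3 n, mul_pow, mul_pow, ← pow_mul, mul_comm 2 n, pow_mul]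
  set w := (C ω : ℂ⟦X⟧) ^ n
  set x := (X : ℂ⟦X⟧) ^ n
  linear_combination (-x + x ^ 2 * w - x ^ 3 * (w - 1)) * hn'

theorem cubicNorm_signedProd_of_not_dvd (hω : ω ^ 2 + ω + 1 = 0) {i s : ℕ} (hs : 0 < s)
    (h3 : 3 ∣ s) (hi : ¬ 3 ∣ i) :
    cubicNorm ω (signedProd (-1) i s) = complexify (signedProd (-1) (3 * i) (3 * s)) := by
  rw [signedProd_neg_one, signedProd_neg_one,
    (multipliable_neg_one i hs).map_tprod _ (continuous_cubicNorm ω),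
    (multipliable_neg_one (3 * i) (s := 3 * s) (by omega)).map_tprod _ continuous_complexify]
  congr 1
  ext1 k
  rw [cubicNorm_one_sub_X_pow_of_not_dvd hω, mul_add, mul_assoc]
  rwa [Nat.dvd_add_left (h3.mul_right k)]

theorem cubicNorm_signedProd_of_dvd (hω : ω ^ 2 + ω + 1 = 0) {i s : ℕ} (hs : 0 < s)
    (h3 : 3 ∣ s) (hi : 3 ∣ i) :
    cubicNorm ω (signedProd (-1) i s) = complexify (signedProd (-1) i s ^ 3) := by
  have h := multipliable_neg_one i hs
  rw [signedProd_neg_one, h.map_tprod _ (continuous_cubicNorm ω), map_pow,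
    h.map_tprod _ continuous_complexify]
  refine Eq.trans ?_ ((h.map _ continuous_complexify).tprod_pow 3)
  congr 1
  ext1 k
  rw [cubicNorm_one_sub_X_pow_of_dvd hω ((Nat.dvd_add_right hi).2 (h3.mul_right k)), map_pow]
  rfl

/-- The factors of f_k whose index is divisible by 3 form f_(3k) and are cubed. The others have X
replaced by X³ and give f_(3k)/f_(9k). -/
theorem cubicNorm_eulerF (hω : ω ^ 2 + ω + 1 = 0) {k : ℕ} (hk : ¬ 3 ∣ k) :
    cubicNorm ω (eulerF k) * complexify (eulerF (9 * k)) = complexify (eulerF (3 * k) ^ 4) := by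
  have hk0 : 0 < k := Nat.pos_of_ne_zero fun h => hk (h ▸ dvd_zero 3)
  have h1 := signedProd_split (-1) k (s := k) (m := 3) hk0 three_pos
  have h2 := signedProd_split (-1) (3 * k) (s := 3 * k) (m := 3) (by omega) three_pos
  simp only [Finset.prod_range_succ, Finset.range_zero, Finset.prod_empty, one_mul, mul_zero,
    add_zero, mul_one] at h1 h2
  have e1 : k + k * 2 = 3 * k := by ring
  have e2 : 3 * k + 3 * k * 2 = 9 * k := by ring
  have e3 : 3 * k * 3 = 9 * k := by ring
  have e4 : 3 * (3 * k) = 9 * k := by ring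
  rw [e1, mul_comm k 3, signedProd_neg_one_self, signedProd_neg_one_self] at h1
  rw [e2, e3, signedProd_neg_one_self, signedProd_neg_one_self] at h2
  have h4 := cubicNorm_signedProd_of_dvd hω (i := 3 * k) (s := 3 * k) (by omega)
    (dvd_mul_right 3 k) (dvd_mul_right 3 k)
  rw [signedProd_neg_one_self] at h4
  rw [h1, map_mul, map_mul,
    cubicNorm_signedProd_of_not_dvd hω (by omega) (dvd_mul_right 3 k) hk,
    cubicNorm_signedProd_of_not_dvd hω (by omega) (dvd_mul_right 3 k) (by omega), h4,
    ← map_mul, ← map_mul, ← map_mul, e4, mul_add]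
  congr 1
  linear_combination -eulerF (3 * k) ^ 3 * h2

end Norm

/-! ### 3-dissections of the theta series and their cubic relations. -/

theorem exists_primitive_cube_root : ∃ ω : ℂ, ω ^ 2 + ω + 1 = 0 := by
  have h1 := (Complex.isPrimitiveRoot_exp 3 three_ne_zero).geom_sum_eq_zero (by norm_num)
  simp only [Finset.sum_range_succ, Finset.range_zero, Finset.sum_empty] at h1
  exact ⟨_, by linear_combination h1⟩

theorem tsum_mul_X_pow_eq_sum {ι κ : Type*} {n : ℕ} (w : κ → ℚ⟦X⟧) (e : κ → ℕ)
    (he : ∀ d, {i | e i ≤ d}.Finite) (g : Fin n → ι → κ)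
    (hg : Function.Bijective fun p : Fin n × ι => g p.1 p.2) :
    ∑' i, w i * X ^ e i = ∑ r, ∑' i, w (g r i) * X ^ e (g r i) := by
  rw [← (Equiv.ofBijective _ hg).tsum_eq, Summable.tsum_prod', tsum_fintype]
  · rfl
  · exact summable_mul_X_pow (fun p : Fin n × ι => w (g p.1 p.2)) (fun p => e (g p.1 p.2))
      fun d => (he d).preimage hg.1.injOn
  · intro r
    refine summable_mul_X_pow (fun i => w (g r i)) (fun i => e (g r i)) fun d =>
      (he d).preimage fun i _ j _ hij => ?_
    have := @hg.1 (r, i) (r, j) hij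
    simpa using this

theorem tsum_thetaTerm_eq_sum (ε : ℤˣ) {i j : ℕ} (hi : 0 < i) (hj : 0 < j) {n : ℕ}
    (g : Fin n → ℤ → ℤ) (hg : Function.Bijective fun p : Fin n × ℤ => g p.1 p.2) :
    ∑' l, thetaTerm ε i j l = ∑ r, ∑' l, thetaTerm ε i j (g r l) :=
  tsum_mul_X_pow_eq_sum _ _ (finite_theta_exponent_le hi hj) g hg

theorem expand_thetaTerm {m : ℕ} (hm : m ≠ 0) (ε : ℤˣ) (i j : ℕ) (l : ℤ) :
    expand m hm (thetaTerm ε i j l) =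
      (((ε ^ l : ℤˣ) : ℤ) : ℚ⟦X⟧) * X ^ (m * (i * triangular l + j * triangular (l - 1))) := by
  rw [thetaTerm, map_mul, map_intCast, map_pow, expand_X, ← pow_mul]

theorem expand_tsum_thetaTerm {m : ℕ} (hm : m ≠ 0) (ε : ℤˣ) {i j : ℕ} (hi : 0 < i) (hj : 0 < j) :
    expand m hm (∑' l, thetaTerm ε i j l) = ∑' l, expand m hm (thetaTerm ε i j l) :=
  (summable_thetaTerm ε hi hj).map_tsum _ (continuous_expand hm)

theorem summable_expand_thetaTerm {m : ℕ} (hm : m ≠ 0) (ε : ℤˣ) {i j : ℕ} (hi : 0 < i)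
    (hj : 0 < j) : Summable fun l => expand m hm (thetaTerm ε i j l) :=
  (summable_thetaTerm ε hi hj).map _ (continuous_expand hm)

theorem summable_expand_expand_thetaTerm {m : ℕ} (hm : m ≠ 0) (ε : ℤˣ) {i j : ℕ} (hi : 0 < i)
    (hj : 0 < j) : Summable fun l => expand m hm (expand m hm (thetaTerm ε i j l)) :=
  (summable_expand_thetaTerm hm ε hi hj).map _ (continuous_expand hm)

theorem expand_expand_tsum_thetaTerm {m : ℕ} (hm : m ≠ 0) (ε : ℤˣ) {i j : ℕ} (hi : 0 < i)
    (hj : 0 < j) : expand m hm (expand m hm (∑' l, thetaTerm ε i j l)) =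
      ∑' l, expand m hm (expand m hm (thetaTerm ε i j l)) := by
  rw [expand_tsum_thetaTerm _ _ hi hj]
  exact (summable_expand_thetaTerm hm ε hi hj).map_tsum _ (continuous_expand hm)

/-- The decomposition `3m`, `3m+1`, `-3m-1` of the integers. -/
def mulThreeSplit : Fin 3 → ℤ → ℤ := ![fun m => 3 * m, fun m => 3 * m + 1, fun m => -(3 * m) - 1]

theorem bijective_mulThreeSplit :
    Function.Bijective fun p : Fin 3 × ℤ => mulThreeSplit p.1 p.2 := by
  constructor
  · rintro ⟨r, m⟩ ⟨r', m'⟩ h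
    fin_cases r <;> fin_cases r' <;> simp [mulThreeSplit] at h ⊢ <;> omega
  · intro l
    obtain h | h | h : l % 3 = 0 ∨ l % 3 = 1 ∨ l % 3 = 2 := by omega
    · exact ⟨(0, l / 3), by simp [mulThreeSplit]; omega⟩
    · exact ⟨(1, l / 3), by simp [mulThreeSplit]; omega⟩
    · exact ⟨(2, (-l - 1) / 3), by simp [mulThreeSplit]; omega⟩

/-- The decomposition `2m`, `-2m-1` of the integers. -/
def mulTwoSplit : Fin 2 → ℤ → ℤ := ![fun m => 2 * m, fun m => -(2 * m) - 1]

theorem bijective_mulTwoSplit :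
    Function.Bijective fun p : Fin 2 × ℤ => mulTwoSplit p.1 p.2 := by
  constructor
  · rintro ⟨r, m⟩ ⟨r', m'⟩ h
    fin_cases r <;> fin_cases r' <;> simp [mulTwoSplit] at h ⊢ <;> omega
  · intro l
    obtain h | h : l % 2 = 0 ∨ l % 2 = 1 := by omega
    · exact ⟨(0, l / 2), by simp [mulTwoSplit]; omega⟩
    · exact ⟨(1, (-l - 1) / 2), by simp [mulTwoSplit]; omega⟩

theorem neg_one_zpow_three_mul (m : ℤ) : (-1 : ℤˣ) ^ (3 * m) = (-1) ^ m := by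
  rw [zpow_mul]; rfl

/-- The exponent is l². Multiples of 3 give the series in X⁹; l = 3m + 1 and its negative contribute
equally, whence the factor 2, and their odd offset gives the minus sign. -/
theorem phiSeries_eq : phiSeries = expand 3 three_ne_zero (expand 3 three_ne_zero phiSeries) +
    X * expand 3 three_ne_zero (-2 * omegaSeries) := by
  have h0 : ∀ m, thetaTerm (-1) 1 1 (3 * m) =
      expand 3 three_ne_zero (expand 3 three_ne_zero (thetaTerm (-1) 1 1 m)) := by
    intro m
    rw [← expand_mul, expand_thetaTerm, thetaTerm, neg_one_zpow_three_mul]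
    congr 2
    have t1 := two_mul_triangular (3 * m)
    have t2 := two_mul_triangular (3 * m - 1)
    have t3 := two_mul_triangular m
    have t4 := two_mul_triangular (m - 1)
    zify
    linarith
  have h1 : ∀ m, thetaTerm (-1) 1 1 (3 * m + 1) =
      -X * expand 3 three_ne_zero (thetaTerm (-1) 5 1 m) := by
    intro m
    rw [expand_thetaTerm, thetaTerm, zpow_add, neg_one_zpow_three_mul]
    have : 1 * triangular (3 * m + 1) + 1 * triangular (3 * m + 1 - 1) =
        3 * (5 * triangular m + 1 * triangular (m - 1)) + 1 := by
      have t1 := two_mul_triangular (3 * m + 1)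
      have t2 := two_mul_triangular (3 * m + 1 - 1)
      have t3 := two_mul_triangular m
      have t4 := two_mul_triangular (m - 1)
      zify
      linarith
    rw [this, pow_succ]
    simp
    ring
  have h2 : ∀ m, thetaTerm (-1) 1 1 (-(3 * m) - 1) =
      -X * expand 3 three_ne_zero (thetaTerm (-1) 5 1 m) := by
    intro m
    rw [← h1, thetaTerm, thetaTerm]
    have hs : (-1 : ℤˣ) ^ (-(3 * m) - 1) = (-1) ^ (3 * m + 1) := by
      rw [show -(3 * m) - 1 = -(3 * m + 1) by ring, zpow_neg]
      exact Int.units_inv_eq_self _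
    rw [hs]
    congr 2
    have t1 := two_mul_triangular (3 * m + 1)
    have t2 := two_mul_triangular (3 * m + 1 - 1)
    have t3 := two_mul_triangular (-(3 * m) - 1)
    have t4 := two_mul_triangular (-(3 * m) - 1 - 1)
    zify
    linarith
  have s := summable_expand_thetaTerm three_ne_zero (-1) (i := 5) (j := 1) (by norm_num) one_pos
  have key := tsum_thetaTerm_eq_sum (-1) one_pos one_pos _ bijective_mulThreeSplit
  simp only [Fin.sum_univ_three, mulThreeSplit, Matrix.cons_val_zero, Matrix.cons_val_one,
    Matrix.cons_val, h0, h1, h2] at key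
  conv_lhs => rw [phiSeries]
  rw [key, s.tsum_mul_left, ← expand_tsum_thetaTerm _ _ (by norm_num) one_pos, ← omegaSeries,
    phiSeries, expand_expand_tsum_thetaTerm _ _ one_pos one_pos, map_mul, map_neg, map_ofNat]
  ring

/-- The exponent is 2l² + l. The classes 3m and 3m + 1 supply the even and the odd indices of the
pentagonal series in X³, and -3m - 1 has exponent 9(2m² + m) + 1. -/
theorem psiSeries_eq : psiSeries = expand 3 three_ne_zero pentSeries +
    X * expand 3 three_ne_zero (expand 3 three_ne_zero psiSeries) := by
  have h0 : ∀ m, thetaTerm 1 3 1 (3 * m) =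
      expand 3 three_ne_zero (thetaTerm 1 2 1 (2 * m)) := by
    intro m
    rw [expand_thetaTerm, thetaTerm, one_zpow, one_zpow]
    congr 2
    have t1 := two_mul_triangular (3 * m)
    have t2 := two_mul_triangular (3 * m - 1)
    have t3 := two_mul_triangular (2 * m)
    have t4 := two_mul_triangular (2 * m - 1)
    zify
    linarith
  have h1 : ∀ m, thetaTerm 1 3 1 (3 * m + 1) =
      expand 3 three_ne_zero (thetaTerm 1 2 1 (-(2 * m) - 1)) := by
    intro m
    rw [expand_thetaTerm, thetaTerm, one_zpow, one_zpow]
    congr 2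
    have t1 := two_mul_triangular (3 * m + 1)
    have t2 := two_mul_triangular (3 * m + 1 - 1)
    have t3 := two_mul_triangular (-(2 * m) - 1)
    have t4 := two_mul_triangular (-(2 * m) - 1 - 1)
    zify
    linarith
  have h2 : ∀ m, thetaTerm 1 3 1 (-(3 * m) - 1) =
      X * expand 3 three_ne_zero (expand 3 three_ne_zero (thetaTerm 1 3 1 m)) := by
    intro m
    rw [← expand_mul, expand_thetaTerm, thetaTerm, one_zpow, one_zpow, mul_left_comm, ← pow_succ']
    congr 2
    have t1 := two_mul_triangular (-(3 * m) - 1)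
    have t2 := two_mul_triangular (-(3 * m) - 1 - 1)
    have t3 := two_mul_triangular m
    have t4 := two_mul_triangular (m - 1)
    zify
    linarith
  have key := tsum_thetaTerm_eq_sum 1 (i := 3) three_pos one_pos _ bijective_mulThreeSplit
  have key2 := tsum_thetaTerm_eq_sum 1 (i := 2) two_pos one_pos _ bijective_mulTwoSplit
  have inj : ∀ r, Function.Injective (mulTwoSplit r) := fun r m m' h => by
    have := @bijective_mulTwoSplit.1 (r, m) (r, m') h
    simpa using this
  have s : ∀ r, Summable fun l => thetaTerm 1 2 1 (mulTwoSplit r l) := fun r =>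
    summable_mul_X_pow _ (fun l => 2 * triangular (mulTwoSplit r l) +
      1 * triangular (mulTwoSplit r l - 1)) fun d =>
      (finite_theta_exponent_le two_pos one_pos d).preimage (inj r).injOn
  have s0 := (s 0).map_tsum _ (continuous_expand three_ne_zero)
  have s1 := (s 1).map_tsum _ (continuous_expand three_ne_zero)
  have s2 := summable_expand_expand_thetaTerm three_ne_zero 1 (i := 3) three_pos one_pos
  simp only [Fin.sum_univ_three, Fin.sum_univ_two, mulThreeSplit, mulTwoSplit,
    Matrix.cons_val_zero, Matrix.cons_val_one,
    Matrix.cons_val, h0, h1, h2] at key key2 s0 s1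
  conv_lhs => rw [psiSeries]
  rw [key, pentSeries, key2, map_add, s0, s1, psiSeries,
    expand_expand_tsum_thetaTerm _ _ three_pos one_pos, s2.tsum_mul_left]

/-- The norm of `phiSeries` is computed twice, from its 3-dissection and from its Euler-product
formula. Both results are series in X³, and X³ is then replaced by X. -/
theorem phi_cubic_relation :
    (expand 3 three_ne_zero phiSeries ^ 3 - 8 * X * omegaSeries ^ 3) *
      (eulerF 2 ^ 4 * eulerF 3 ^ 2) = eulerF 1 ^ 8 * eulerF 6 := by
  obtain ⟨ω, hω⟩ := exists_primitive_cube_root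
  have h1 := cubicNorm_eulerF hω (k := 1) (by norm_num)
  have h2 := cubicNorm_eulerF hω (k := 2) (by norm_num)
  have h3 := congrArg (cubicNorm ω) phiSeries_mul
  have h4 := cubicNorm_add_X_mul hω (expand 3 three_ne_zero phiSeries) (-2 * omegaSeries)
  rw [← phiSeries_eq] at h4
  rw [map_mul, map_pow, h4] at h3
  norm_num only [] at h1 h2
  apply expand_injective three_ne_zero
  apply complexify_injective
  simp only [map_mul, map_pow, expand_eulerF three_ne_zero (Nat.succ_pos _)]
    at h1 h2 h3 ⊢
  have e : expand 3 three_ne_zero phiSeries ^ 3 - 8 * X * omegaSeries ^ 3 =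
      expand 3 three_ne_zero phiSeries ^ 3 + X * (-2 * omegaSeries) ^ 3 := by ring
  rw [e]
  set Y := complexify (expand 3 three_ne_zero
    (expand 3 three_ne_zero phiSeries ^ 3 + X * (-2 * omegaSeries) ^ 3))
  rw [← h2]
  linear_combination complexify (eulerF 9) ^ 2 * complexify (eulerF 18) * h3 +
    complexify (eulerF 18) * (cubicNorm ω (eulerF 1) * complexify (eulerF 9) +
      complexify (eulerF 3) ^ 4) * h1

theorem psi_cubic_relation :
    (pentSeries ^ 3 + X * expand 3 three_ne_zero psiSeries ^ 3) * (eulerF 1 ^ 4 * eulerF 6 ^ 2) =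
      eulerF 2 ^ 8 * eulerF 3 := by
  obtain ⟨ω, hω⟩ := exists_primitive_cube_root
  have h1 := cubicNorm_eulerF hω (k := 1) (by norm_num)
  have h2 := cubicNorm_eulerF hω (k := 2) (by norm_num)
  have h3 := congrArg (cubicNorm ω) psiSeries_mul
  have h4 := cubicNorm_add_X_mul hω pentSeries (expand 3 three_ne_zero psiSeries)
  rw [← psiSeries_eq] at h4
  rw [map_mul, map_pow, h4] at h3
  norm_num only [] at h1 h2
  apply expand_injective three_ne_zero
  apply complexify_injective
  simp only [map_mul, map_pow, expand_eulerF three_ne_zero (Nat.succ_pos _)]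
    at h1 h2 h3 ⊢
  set Y := complexify (expand 3 three_ne_zero
    (pentSeries ^ 3 + X * expand 3 three_ne_zero psiSeries ^ 3))
  rw [← h1]
  linear_combination complexify (eulerF 18) ^ 2 * complexify (eulerF 9) * h3 +
    complexify (eulerF 9) * (cubicNorm ω (eulerF 2) * complexify (eulerF 18) +
      complexify (eulerF 6) ^ 4) * h2

/-! ### Generating functions of exponent maps with finite sublevel sets. -/

/-- All the sublevel sets of `e` are finite. -/
def FiniteSublevels {ι : Type*} (e : ι → ℕ) : Prop := ∀ d, {i | e i ≤ d}.Finite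

/-- The generating function `∑ X ^ e i`. -/
noncomputable def powSum {ι : Type*} (e : ι → ℕ) : ℚ⟦X⟧ := ∑' i, X ^ e i

namespace FiniteSublevels

variable {ι κ : Type*} {e : ι → ℕ} {e' : κ → ℕ}

theorem summable (he : FiniteSublevels e) : Summable fun i => (X : ℚ⟦X⟧) ^ e i := by
  simpa using summable_mul_X_pow (fun _ => 1) e he

theorem comp (he : FiniteSublevels e) {g : κ → ι} (hg : Function.Injective g) :
    FiniteSublevels fun i => e (g i) :=
  fun d => (he d).preimage hg.injOn

theorem add (he : FiniteSublevels e) (he' : FiniteSublevels e') :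
    FiniteSublevels fun p : ι × κ => e p.1 + e' p.2 :=
  fun d => ((he d).prod (he' d)).subset fun p hp => by
    simp only [Set.mem_ofPred_eq, Set.mem_prod] at hp ⊢
    omega

theorem mul_left (he : FiniteSublevels e) {m : ℕ} (hm : m ≠ 0) :
    FiniteSublevels fun i => m * e i :=
  fun d => (he d).subset fun i hi => by
    have : e i ≤ m * e i := Nat.le_mul_of_pos_left _ (Nat.pos_of_ne_zero hm)
    simp only [Set.mem_ofPred_eq] at hi ⊢
    omega

theorem powSum_mul (he : FiniteSublevels e) (he' : FiniteSublevels e') :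
    powSum e * powSum e' = powSum fun p : ι × κ => e p.1 + e' p.2 := by
  have h := (he.add he').summable
  simp only [pow_add] at h
  rw [powSum, powSum, he.summable.tsum_mul_tsum he'.summable h]
  simp only [powSum, pow_add]

theorem expand_powSum (he : FiniteSublevels e) {m : ℕ} (hm : m ≠ 0) :
    expand m hm (powSum e) = powSum fun i => m * e i := by
  rw [powSum, he.summable.map_tsum _ (continuous_expand hm)]
  simp only [map_pow, expand_X, powSum, pow_mul]

theorem powSum_add_one (he : FiniteSublevels e) :
    powSum (fun i => e i + 1) = X * powSum e := by
  simp only [powSum, pow_succ']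
  exact he.summable.tsum_mul_left X

theorem powSum_eq_sum (he : FiniteSublevels e) {n : ℕ} (g : Fin n → κ → ι)
    (hg : Function.Bijective fun p : Fin n × κ => g p.1 p.2) :
    powSum e = ∑ r, powSum fun i => e (g r i) := by
  simpa [powSum] using tsum_mul_X_pow_eq_sum (fun _ => 1) e he g hg

theorem coeff_powSum (he : FiniteSublevels e) (d : ℕ) :
    coeff d (powSum e) = ({i | e i = d}.ncard : ℚ) := by
  have hfin : {i | e i = d}.Finite := (he d).subset fun i (hi : e i = d) => hi.le
  have h := (PowerSeries.WithPiTopology.hasSum_iff_hasSum_coeff ℚ).1 he.summable.hasSum d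
  have h2 : HasSum (fun i => coeff d ((X : ℚ⟦X⟧) ^ e i))
      (∑ i ∈ hfin.toFinset, coeff d ((X : ℚ⟦X⟧) ^ e i)) := hasSum_sum_of_ne_finset_zero (f := fun i => coeff d ((X : ℚ⟦X⟧) ^ e i))
    (s := hfin.toFinset) (fun i hi => by
      simp only [Set.Finite.mem_toFinset, Set.mem_ofPred_eq] at hi
      rw [coeff_X_pow, if_neg (Ne.symm hi)])
  refine (h.unique h2).trans ?_
  rw [Set.ncard_eq_toFinset_card _ hfin, Finset.sum_congr rfl (g := fun _ => (1 : ℚ))]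
  · simp
  · intro i hi
    simp only [Set.Finite.mem_toFinset, Set.mem_ofPred_eq] at hi
    rw [coeff_X_pow, if_pos hi.symm]

end FiniteSublevels

theorem powSum_comp {ι κ : Type*} (e : ι → ℕ) {g : κ → ι} (hg : Function.Bijective g) :
    powSum (fun i => e (g i)) = powSum e :=
  (Equiv.ofBijective g hg).tsum_eq fun i => (X : ℚ⟦X⟧) ^ e i

/-! ### Hexagonal theta series and the product formula for 3-cores. -/

/-- The exponent `x² + xy + y² + x + y`. -/
def eisensteinExp (p : ℤ × ℤ) : ℕ := (p.1 ^ 2 + p.1 * p.2 + p.2 ^ 2 + p.1 + p.2).toNat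

/-- With z = -1 - x - y the exponent becomes symmetric in x, y, z; the cyclic symmetry drives the
decompositions of ℤ² and ℤ³ below. -/
theorem two_mul_eisensteinExp (p : ℤ × ℤ) :
    2 * (eisensteinExp p : ℤ) + 1 = p.1 ^ 2 + p.2 ^ 2 + (-1 - p.1 - p.2) ^ 2 := by
  obtain ⟨x, y⟩ := p
  have h : 0 ≤ x ^ 2 + x * y + y ^ 2 + x + y := by
    have : 0 ≤ x ^ 2 + y ^ 2 + (-1 - x - y) ^ 2 := by positivity
    have h2 : x ^ 2 + y ^ 2 + (-1 - x - y) ^ 2 = 2 * (x ^ 2 + x * y + y ^ 2 + x + y) + 1 := by ring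
    omega
  simp only [eisensteinExp, Int.toNat_of_nonneg h]
  ring

theorem finiteSublevels_eisensteinExp : FiniteSublevels eisensteinExp := by
  intro d
  refine (((Set.finite_Icc (-(2 * d + 1) : ℤ) (2 * d + 1)).prod
    (Set.finite_Icc (-(2 * d + 1) : ℤ) (2 * d + 1)))).subset ?_
  rintro ⟨x, y⟩ hp
  have hd : eisensteinExp (x, y) ≤ d := hp
  have h := two_mul_eisensteinExp (x, y)
  simp only at h
  have hd' : (eisensteinExp (x, y) : ℤ) ≤ d := by exact_mod_cast hd
  have hz := sq_nonneg (-1 - x - y)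
  simp only [Set.mem_prod, Set.mem_Icc]
  refine ⟨⟨?_, ?_⟩, ?_, ?_⟩ <;>
    nlinarith [sq_nonneg x, sq_nonneg y, Int.le_self_sq x, Int.le_self_sq y, Int.le_self_sq (-x),
      Int.le_self_sq (-y)]

theorem injective_conePoint :
    Function.Injective fun p : ℕ × ℕ => (((p.2 : ℤ) - p.1, (p.1 : ℤ)) : ℤ × ℤ) := by
  rintro ⟨a, b⟩ ⟨a', b'⟩ h
  simp only [Prod.mk.injEq] at h ⊢
  omega

/-- The size of the `3`-core with parameters `(a, b)`, that is `a² - ab + b² + b`. -/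
def coreSize (p : ℕ × ℕ) : ℕ := eisensteinExp ((p.2 : ℤ) - p.1, (p.1 : ℤ))

theorem finiteSublevels_coreSize : FiniteSublevels coreSize :=
  finiteSublevels_eisensteinExp.comp injective_conePoint

/-- The cyclic rotations of the triple (b - a, a, -1 - b), with a, b ≥ 0, tile the plane x + y + z =
-1 by three cones on which the exponent takes the same values. -/
theorem powSum_eisensteinExp : powSum eisensteinExp = 3 * powSum coreSize := by
  have h := finiteSublevels_eisensteinExp.powSum_eq_sum (κ := ℕ × ℕ)
    ![fun p => ((p.2 : ℤ) - p.1, (p.1 : ℤ)), fun p => ((p.1 : ℤ), -p.2 - 1),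
      fun p => (-p.2 - 1, (p.2 : ℤ) - p.1)] (by
    constructor
    · rintro ⟨r, a, b⟩ ⟨r', a', b'⟩ h
      fin_cases r <;> fin_cases r' <;> simp at h ⊢ <;> omega
    · rintro ⟨x, y⟩
      by_cases h1 : 0 ≤ y ∧ 0 ≤ x + y
      · exact ⟨(0, y.toNat, (x + y).toNat), by simp; omega⟩
      by_cases h2 : 0 ≤ x ∧ y < 0
      · exact ⟨(1, x.toNat, (-y - 1).toNat), by simp; omega⟩
      · exact ⟨(2, (-1 - x - y).toNat, (-x - 1).toNat), by simp; omega⟩)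
  have e1 : ∀ p : ℕ × ℕ, eisensteinExp ((p.1 : ℤ), -p.2 - 1) = coreSize p := fun p => by
    have h1 := two_mul_eisensteinExp ((p.1 : ℤ), -p.2 - 1)
    have h2 := two_mul_eisensteinExp ((p.2 : ℤ) - p.1, (p.1 : ℤ))
    rw [coreSize]
    zify
    simp only at h1 h2
    linarith
  have e2 : ∀ p : ℕ × ℕ, eisensteinExp (-p.2 - 1, (p.2 : ℤ) - p.1) = coreSize p := fun p => by
    have h1 := two_mul_eisensteinExp (-p.2 - 1, (p.2 : ℤ) - p.1)
    have h2 := two_mul_eisensteinExp ((p.2 : ℤ) - p.1, (p.1 : ℤ))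
    rw [coreSize]
    zify
    simp only at h1 h2
    linarith
  simp only [Fin.sum_univ_three, Matrix.cons_val_zero, Matrix.cons_val_one, Matrix.cons_val, e1,
    e2] at h
  rw [h]
  change powSum coreSize + _ + _ = _
  ring

theorem finiteSublevels_theta {i j : ℕ} (hi : 0 < i) (hj : 0 < j) :
    FiniteSublevels fun l : ℤ => i * triangular l + j * triangular (l - 1) :=
  finite_theta_exponent_le hi hj

theorem psiSeries_eq_powSum :
    psiSeries = powSum fun l : ℤ => 3 * triangular l + 1 * triangular (l - 1) := by
  simp [psiSeries, powSum, thetaTerm]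

theorem pentSeries_eq_powSum :
    pentSeries = powSum fun l : ℤ => 2 * triangular l + 1 * triangular (l - 1) := by
  simp [pentSeries, powSum, thetaTerm]

/-- Completing the square: the form is 2s² + s + v(3v + 1)/2 with s = u + v/2. For odd v, s is a
half-integer, and 2s² + s = 2l² + l for the integer l = -(s + 1/2). -/
theorem psiSeries_mul_pentSeries : psiSeries * pentSeries =
    powSum fun p : ℤ × ℤ => (2 * p.1 ^ 2 + 2 * p.1 * p.2 + 2 * p.2 ^ 2 + p.1 + p.2).toNat := by
  rw [psiSeries_eq_powSum, pentSeries_eq_powSum,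
    (finiteSublevels_theta three_pos one_pos).powSum_mul (finiteSublevels_theta two_pos one_pos),
    ← powSum_comp _ (g := fun p : ℤ × ℤ =>
      (if p.2 % 2 = 0 then p.1 + p.2 / 2 else -(p.1 + (p.2 + 1) / 2), p.2))]
  · congr 1
    ext1 ⟨u, v⟩
    apply Int.natCast_inj.1
    have hnn : 0 ≤ 2 * u ^ 2 + 2 * u * v + 2 * v ^ 2 + u + v := by
      nlinarith [sq_nonneg (u + v), Int.le_self_sq (-u), Int.le_self_sq (-v)]
    rw [Int.toNat_of_nonneg hnn]
    dsimp only
    have t3 := two_mul_triangular v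
    have t4 := two_mul_triangular (v - 1)
    split_ifs with h
    · obtain ⟨w, rfl⟩ : ∃ w, v = 2 * w := ⟨v / 2, by omega⟩
      rw [Int.mul_ediv_cancel_left _ two_ne_zero]
      have t1 := two_mul_triangular (u + w)
      have t2 := two_mul_triangular (u + w - 1)
      push_cast
      linarith
    · obtain ⟨w, rfl⟩ : ∃ w, v = 2 * w - 1 := ⟨(v + 1) / 2, by omega⟩
      rw [sub_add_cancel, Int.mul_ediv_cancel_left _ two_ne_zero]
      have t1 := two_mul_triangular (-(u + w))
      have t2 := two_mul_triangular (-(u + w) - 1)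
      push_cast
      linarith
  · constructor
    · rintro ⟨u, v⟩ ⟨u', v'⟩ h
      simp only [Prod.mk.injEq] at h ⊢
      obtain ⟨h, rfl⟩ := h
      split_ifs at h <;> omega
    · rintro ⟨i, k⟩
      by_cases h : k % 2 = 0
      · exact ⟨(i - k / 2, k), by simp [h]⟩
      · exact ⟨(-i - (k + 1) / 2, k), by simp [h]⟩

/-- Since x + y + z = -1 is odd, either all three coordinates are odd or exactly one is. The map t ↦
-2t - 1 produces the first class and turns the exponent E into 4E + 1; the other three classes are
cyclic rotations of one another and have even exponents. -/
theorem powSum_coreSize_eq : powSum coreSize =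
    expand 2 two_ne_zero (psiSeries * pentSeries) +
      X * expand 4 four_ne_zero (powSum coreSize) := by
  have h := finiteSublevels_eisensteinExp.powSum_eq_sum (κ := ℤ × ℤ)
    ![fun p => (-2 * p.1 - 1, -2 * p.2 - 1), fun p => (2 * p.1, 2 * p.2),
      fun p => (2 * p.2, -1 - 2 * p.1 - 2 * p.2), fun p => (-1 - 2 * p.1 - 2 * p.2, 2 * p.1)] (by
    constructor
    · rintro ⟨r, a, b⟩ ⟨r', a', b'⟩ h
      fin_cases r <;> fin_cases r' <;> simp at h ⊢ <;> omega
    · rintro ⟨x, y⟩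
      by_cases hx : x % 2 = 0 <;> by_cases hy : y % 2 = 0
      · exact ⟨(1, x / 2, y / 2), by simp; omega⟩
      · exact ⟨(2, (-1 - x - y) / 2, x / 2), by simp; omega⟩
      · exact ⟨(3, y / 2, (-1 - x - y) / 2), by simp; omega⟩
      · exact ⟨(0, -(x + 1) / 2, -(y + 1) / 2), by simp; omega⟩)
  have e0 : ∀ p : ℤ × ℤ, eisensteinExp (-2 * p.1 - 1, -2 * p.2 - 1) = 4 * eisensteinExp p + 1 := by
    intro p
    have h1 := two_mul_eisensteinExp (-2 * p.1 - 1, -2 * p.2 - 1)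
    have h2 := two_mul_eisensteinExp p
    zify
    simp only at h1
    linarith
  have hnn : ∀ p : ℤ × ℤ, 0 ≤ 2 * p.1 ^ 2 + 2 * p.1 * p.2 + 2 * p.2 ^ 2 + p.1 + p.2 := fun p => by
    nlinarith [sq_nonneg (p.1 + p.2), Int.le_self_sq (-p.1), Int.le_self_sq (-p.2)]
  have e1 : ∀ p : ℤ × ℤ, eisensteinExp (2 * p.1, 2 * p.2) =
      2 * (2 * p.1 ^ 2 + 2 * p.1 * p.2 + 2 * p.2 ^ 2 + p.1 + p.2).toNat := by
    intro p
    have h1 := two_mul_eisensteinExp (2 * p.1, 2 * p.2)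
    zify
    rw [Int.toNat_of_nonneg (hnn p)]
    simp only at h1
    linarith
  have e2 : ∀ p : ℤ × ℤ, eisensteinExp (2 * p.2, -1 - 2 * p.1 - 2 * p.2) =
      2 * (2 * p.1 ^ 2 + 2 * p.1 * p.2 + 2 * p.2 ^ 2 + p.1 + p.2).toNat := by
    intro p
    have h1 := two_mul_eisensteinExp (2 * p.2, -1 - 2 * p.1 - 2 * p.2)
    zify
    rw [Int.toNat_of_nonneg (hnn p)]
    simp only at h1
    linarith
  have e3 : ∀ p : ℤ × ℤ, eisensteinExp (-1 - 2 * p.1 - 2 * p.2, 2 * p.1) =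
      2 * (2 * p.1 ^ 2 + 2 * p.1 * p.2 + 2 * p.2 ^ 2 + p.1 + p.2).toNat := by
    intro p
    have h1 := two_mul_eisensteinExp (-1 - 2 * p.1 - 2 * p.2, 2 * p.1)
    zify
    rw [Int.toNat_of_nonneg (hnn p)]
    simp only at h1
    linarith
  have hfin : FiniteSublevels fun p : ℤ × ℤ =>
      (2 * p.1 ^ 2 + 2 * p.1 * p.2 + 2 * p.2 ^ 2 + p.1 + p.2).toNat := fun d =>
    ((finiteSublevels_eisensteinExp.comp (g := fun p : ℤ × ℤ => (2 * p.1, 2 * p.2))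
      (fun p q h => by ext <;> simp at h <;> omega)) (2 * d)).subset fun p hp => by
      simp only [Set.mem_ofPred_eq, e1] at hp ⊢
      omega
  simp only [Fin.sum_univ_four, Matrix.cons_val_zero, Matrix.cons_val_one, Matrix.cons_val, e0, e1,
    e2, e3] at h
  rw [(finiteSublevels_eisensteinExp.mul_left four_ne_zero).powSum_add_one,
    ← finiteSublevels_eisensteinExp.expand_powSum four_ne_zero, ← hfin.expand_powSum two_ne_zero,
    ← psiSeries_mul_pentSeries, powSum_eisensteinExp, map_mul, map_ofNat] at h
  refine mul_left_cancel₀ (a := (3 : ℚ⟦X⟧)) (fun h0 => by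
    have := congrArg constantCoeff h0
    rw [map_ofNat, map_zero] at this
    norm_num at this) ?_
  linear_combination h

theorem finiteSublevels_triangular : FiniteSublevels triangular := by
  intro d
  refine (Set.finite_Icc (-(2 * d + 1) : ℤ) (2 * d + 1)).subset fun l hl => ?_
  have h := two_mul_triangular l
  have hl' : (triangular l : ℤ) ≤ d := by exact_mod_cast hl
  simp only [Set.mem_Icc]
  constructor <;> nlinarith [Int.le_self_sq l, Int.le_self_sq (-l), Int.le_self_sq (l + 1)]

theorem powSum_triangular : powSum triangular = 2 * psiSeries := by
  have h := finiteSublevels_triangular.powSum_eq_sum _ bijective_mulTwoSplit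
  have e0 : ∀ m, triangular (2 * m) = 3 * triangular m + 1 * triangular (m - 1) := fun m => by
    have t1 := two_mul_triangular (2 * m)
    have t3 := two_mul_triangular m
    have t4 := two_mul_triangular (m - 1)
    zify
    linarith
  have e1 : ∀ m, triangular (-(2 * m) - 1) = triangular (2 * m) := fun m => by
    rw [← triangular_neg_one_sub]; congr 1; ring
  simp only [Fin.sum_univ_two, mulTwoSplit, Matrix.cons_val_zero, Matrix.cons_val_one, e1, e0,
    ← psiSeries_eq_powSum] at h
  rw [h]
  ring

/-- The substitution j = a + b - c, (x, y, z) = (a - b, b + c, -1 - a - c) has mutually orthogonal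
columns in its linear part and diagonalises the exponent. It reaches only j - x + y ≡ 0 mod 3;
rotating (x, y, z) reaches the other two classes. -/
theorem psiSeries_mul_powSum_coreSize : psiSeries * powSum coreSize =
    expand 3 three_ne_zero psiSeries * pentSeries ^ 2 := by
  have hfin := finiteSublevels_triangular.add finiteSublevels_eisensteinExp
  have h := hfin.powSum_eq_sum (κ := ℤ × ℤ × ℤ)
    ![fun n => (n.1 + n.2.1 - n.2.2, n.1 - n.2.1, n.2.1 + n.2.2),
      fun n => (n.1 + n.2.1 - n.2.2, n.2.1 + n.2.2, -n.1 - n.2.2 - 1),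
      fun n => (n.1 + n.2.1 - n.2.2, -n.1 - n.2.2 - 1, n.1 - n.2.1)] (by
    constructor
    · rintro ⟨r, a, b, c⟩ ⟨r', a', b', c'⟩ h
      fin_cases r <;> fin_cases r' <;> simp at h ⊢ <;> omega
    · rintro ⟨j, x, y⟩
      obtain h | h | h : (j - x + y) % 3 = 0 ∨ (j - x + y) % 3 = 1 ∨ (j - x + y) % 3 = 2 := by omega
      · exact ⟨(0, (j + 2 * x + y) / 3, (j - x + y) / 3, (-j + x + 2 * y) / 3), by simp; omega⟩
      · exact ⟨(2, (j - x + y - 1) / 3, (j - x - 2 * y - 1) / 3, (-j - 2 * x - y - 2) / 3),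
          by simp; omega⟩
      · exact ⟨(1, (j - x - 2 * y - 2) / 3, (j + 2 * x + y + 1) / 3, (-j + x - y - 1) / 3),
          by simp; omega⟩)
  have e : ∀ n : ℤ × ℤ × ℤ, ∀ q : ℤ × ℤ,
      q = (n.1 - n.2.1, n.2.1 + n.2.2) ∨ q = (n.2.1 + n.2.2, -n.1 - n.2.2 - 1) ∨
        q = (-n.1 - n.2.2 - 1, n.1 - n.2.1) →
      triangular (n.1 + n.2.1 - n.2.2) + eisensteinExp q =
      3 * triangular n.1 + ((2 * triangular n.2.1 + 1 * triangular (n.2.1 - 1)) +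
        (2 * triangular n.2.2 + 1 * triangular (n.2.2 - 1))) := by
    rintro ⟨a, b, c⟩ q hq
    have t0 := two_mul_triangular (a + b - c)
    have t1 := two_mul_triangular a
    have t2 := two_mul_triangular b
    have t3 := two_mul_triangular (b - 1)
    have t4 := two_mul_triangular c
    have t5 := two_mul_triangular (c - 1)
    have t6 := two_mul_eisensteinExp q
    zify
    rcases hq with rfl | rfl | rfl <;> simp only at t6 ⊢ <;> linarith
  have e0 := fun n : ℤ × ℤ × ℤ => e n _ (Or.inl rfl)
  have e1 := fun n : ℤ × ℤ × ℤ => e n _ (Or.inr (Or.inl rfl))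
  have e2 := fun n : ℤ × ℤ × ℤ => e n _ (Or.inr (Or.inr rfl))
  simp only [Fin.sum_univ_three, Matrix.cons_val_zero, Matrix.cons_val_one, Matrix.cons_val, e0, e1,
    e2] at h
  have hp := finiteSublevels_theta (i := 2) two_pos one_pos
  rw [← finiteSublevels_triangular.powSum_mul finiteSublevels_eisensteinExp,
    ← (finiteSublevels_triangular.mul_left three_ne_zero).powSum_mul (hp.add hp),
    ← hp.powSum_mul hp, ← finiteSublevels_triangular.expand_powSum three_ne_zero,
    powSum_triangular, powSum_eisensteinExp, ← pentSeries_eq_powSum, map_mul, map_ofNat] at h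
  refine mul_left_cancel₀ (a := (6 : ℚ⟦X⟧)) (fun h0 => by
    have := congrArg constantCoeff h0
    rw [map_ofNat, map_zero] at this
    norm_num at this) ?_
  linear_combination h

/-- The preceding identity is solved for the core series: every other factor in it has an
Euler-product formula. -/
theorem powSum_coreSize_mul_eulerF : powSum coreSize * eulerF 1 = eulerF 3 ^ 3 := by
  have h1 := psiSeries_mul_powSum_coreSize
  have h2 := psiSeries_mul
  have h3 := pentSeries_mul
  have h4 := congrArg (expand 3 three_ne_zero) psiSeries_mul
  simp only [map_mul, map_pow, expand_eulerF three_ne_zero (Nat.succ_pos _)] at h4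
  have u : eulerF 2 ^ 2 * (eulerF 1 * eulerF 6 ^ 2 * eulerF 3) ≠ 0 := by
    have h : ∀ k, 0 < k → eulerF k ≠ 0 := fun k hk => (isUnit_eulerF hk).ne_zero
    simp [h]
  apply mul_right_cancel₀ u
  set T := powSum coreSize
  set Q := expand 3 three_ne_zero psiSeries
  linear_combination -(T * eulerF 1 ^ 2 * eulerF 6 ^ 2 * eulerF 3) * h2 +
    eulerF 1 ^ 3 * eulerF 6 ^ 2 * eulerF 3 * h1 +
    Q * eulerF 3 * eulerF 1 * (pentSeries * (eulerF 1 * eulerF 6) + eulerF 2 * eulerF 3 ^ 2) * h3 +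
    eulerF 1 * eulerF 2 ^ 2 * eulerF 3 ^ 4 * h4

/-! ### First-column hook lengths and the core criterion. -/

/-- The first-column hook lengths of a Young diagram, given by the list of its row lengths. -/
def betaList : List ℕ → List ℕ
  | [] => []
  | r :: w => (r + w.length) :: betaList w

/-- The inverse of `betaList`. -/
def unbetaList : List ℕ → List ℕ
  | [] => []
  | x :: l => (x - l.length) :: unbetaList l

@[simp] theorem length_betaList (w : List ℕ) : (betaList w).length = w.length := by
  induction w <;> simp_all [betaList]

@[simp] theorem length_unbetaList (l : List ℕ) : (unbetaList l).length = l.length := by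
  induction l <;> simp_all [unbetaList]

theorem unbetaList_betaList (w : List ℕ) : unbetaList (betaList w) = w := by
  induction w <;> simp_all [betaList, unbetaList]

theorem sum_betaList (w : List ℕ) : (betaList w).sum = w.sum + w.length.choose 2 := by
  induction w with
  | nil => simp [betaList]
  | cons r w ih =>
    simp only [betaList, List.sum_cons, ih, List.length_cons, Nat.choose_succ_succ' w.length 1,
      Nat.choose_one_right]
    ring

theorem length_le_of_forall_lt {l : List ℕ} (hl : l.Pairwise (· > ·)) {x : ℕ}
    (hx : ∀ y ∈ l, y < x) : l.length ≤ x := by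
  induction l generalizing x with
  | nil => simp
  | cons y l ih =>
    rw [List.pairwise_cons] at hl
    have h1 := ih hl.2 hl.1
    have h2 := hx y (by simp)
    simp only [List.length_cons]
    omega

theorem length_lt_of_forall_lt {l : List ℕ} (hl : l.Pairwise (· > ·)) (h0 : 0 ∉ l) {x : ℕ}
    (hx0 : 0 < x) (hx : ∀ y ∈ l, y < x) : l.length < x := by
  induction l generalizing x with
  | nil => simpa
  | cons y l ih =>
    rw [List.pairwise_cons] at hl
    simp only [List.mem_cons, not_or] at h0
    have h1 := ih hl.2 h0.2 (Nat.pos_of_ne_zero (Ne.symm h0.1)) hl.1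
    have h2 := hx y (by simp)
    simp only [List.length_cons]
    omega

theorem betaList_unbetaList {l : List ℕ} (hl : l.Pairwise (· > ·)) :
    betaList (unbetaList l) = l := by
  induction l with
  | nil => rfl
  | cons x l ih =>
    rw [List.pairwise_cons] at hl
    simp only [unbetaList, betaList, ih hl.2, length_unbetaList,
      Nat.sub_add_cancel (length_le_of_forall_lt hl.2 hl.1)]

theorem lt_of_mem_betaList {w : List ℕ} {r : ℕ} (hr : ∀ x ∈ w, x ≤ r) :
    ∀ y ∈ betaList w, y < r + w.length := by
  induction w with
  | nil => simp [betaList]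
  | cons x w ih =>
    intro y hy
    simp only [betaList, List.mem_cons] at hy
    simp only [List.length_cons]
    rcases hy with rfl | hy
    · have := hr x (by simp)
      omega
    · have := ih (fun z hz => hr z (by simp [hz])) y hy
      omega

theorem pairwise_betaList {w : List ℕ} (hw : w.Pairwise (· ≥ ·)) :
    (betaList w).Pairwise (· > ·) := by
  induction w with
  | nil => simp [betaList]
  | cons x w ih =>
    rw [List.pairwise_cons] at hw
    rw [betaList, List.pairwise_cons]
    exact ⟨fun y hy => lt_of_mem_betaList hw.1 y hy, ih hw.2⟩

theorem add_length_le_of_mem_unbetaList {l : List ℕ} (hl : l.Pairwise (· > ·)) {x : ℕ}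
    (hx : ∀ y ∈ l, y < x) : ∀ y ∈ unbetaList l, y + l.length ≤ x := by
  induction l generalizing x with
  | nil => simp [unbetaList]
  | cons z l ih =>
    intro y hy
    rw [List.pairwise_cons] at hl
    have h1 := hx z (by simp)
    have h2 := length_le_of_forall_lt hl.2 hl.1
    simp only [unbetaList, List.mem_cons] at hy
    simp only [List.length_cons]
    rcases hy with rfl | hy
    · omega
    · have := ih hl.2 hl.1 y hy
      omega

theorem pairwise_unbetaList {l : List ℕ} (hl : l.Pairwise (· > ·)) :
    (unbetaList l).Pairwise (· ≥ ·) := by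
  induction l with
  | nil => simp [unbetaList]
  | cons x l ih =>
    rw [List.pairwise_cons] at hl
    rw [unbetaList, List.pairwise_cons]
    refine ⟨fun y hy => ?_, ih hl.2⟩
    have := add_length_le_of_mem_unbetaList hl.2 hl.1 y hy
    omega

theorem pos_of_mem_unbetaList {l : List ℕ} (hl : l.Pairwise (· > ·)) (h0 : 0 ∉ l) :
    ∀ y ∈ unbetaList l, 0 < y := by
  induction l with
  | nil => simp [unbetaList]
  | cons x l ih =>
    rw [List.pairwise_cons] at hl
    simp only [List.mem_cons, not_or] at h0
    intro y hy
    simp only [unbetaList, List.mem_cons] at hy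
    rcases hy with rfl | hy
    · have := length_lt_of_forall_lt hl.2 h0.2 (Nat.pos_of_ne_zero (Ne.symm h0.1)) hl.1
      omega
    · exact ih hl.2 h0.2 y hy

theorem zero_notMem_betaList {w : List ℕ} (hw : ∀ x ∈ w, 0 < x) : 0 ∉ betaList w := by
  induction w with
  | nil => simp [betaList]
  | cons x w ih =>
    have h := hw x (by simp)
    simp only [betaList, List.mem_cons, not_or]
    exact ⟨by omega, ih fun y hy => hw y (by simp [hy])⟩

theorem getElem_betaList (w : List ℕ) (i : ℕ) (hi : i < w.length) :
    (betaList w)[i]'(by simpa using hi) = w[i] + (w.length - 1 - i) := by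
  induction w generalizing i with
  | nil => simp at hi
  | cons r w ih =>
    rcases i with _ | i
    · simp [betaList]
    · simp only [List.length_cons] at hi
      simp only [betaList, List.getElem_cons_succ, List.length_cons, ih i (by omega)]
      omega

namespace YoungDiagram

variable (μ : YoungDiagram)

theorem mem_betaList_rowLens {x : ℕ} : x ∈ betaList μ.rowLens ↔
    ∃ i < μ.colLen 0, x = μ.rowLen i + (μ.colLen 0 - 1 - i) := by
  rw [List.mem_iff_getElem]
  constructor
  · rintro ⟨i, hi, rfl⟩
    simp only [length_betaList] at hi
    refine ⟨i, by simpa using hi, ?_⟩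
    rw [getElem_betaList _ _ hi]
    simp
  · rintro ⟨i, hi, rfl⟩
    refine ⟨i, by simpa using hi, ?_⟩
    rw [getElem_betaList _ _ (by simpa using hi)]
    simp

theorem lt_colLen_iff_lt_rowLen {i j : ℕ} : i < μ.colLen j ↔ j < μ.rowLen i := by
  rw [← mem_iff_lt_colLen, mem_iff_lt_rowLen]

/-- With k rows, column j determines the number k + j - `colLen j`, which is never a first-column
hook length. The hook number of a cell (i, j) is the i-th first-column hook length minus this gap.
-/
theorem rowLen_add_colLen_ne {i j : ℕ} (hi : i < μ.colLen 0) :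
    μ.rowLen i + (μ.colLen 0 - 1 - i) + μ.colLen j ≠ μ.colLen 0 + j := by
  have := μ.lt_colLen_iff_lt_rowLen (i := i) (j := j)
  omega

/-- Every gap comes from a column: if p first-column hook lengths exceed u, then column u + p - k
has length p. -/
theorem exists_add_colLen_eq {u : ℕ} (hu : u ∉ betaList μ.rowLens) :
    ∃ j, u + μ.colLen j = μ.colLen 0 + j := by
  classical
  set k := μ.colLen 0 with hk
  have hex : ∃ i, ¬ (i < k ∧ u < μ.rowLen i + (k - 1 - i)) := ⟨k, by simp⟩
  set p := Nat.find hex with hp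
  have h1 : ∀ i < p, i < k ∧ u < μ.rowLen i + (k - 1 - i) := fun i hi =>
    not_not.1 (Nat.find_min hex hi)
  have h2 : ¬ (p < k ∧ u < μ.rowLen p + (k - 1 - p)) := Nat.find_spec hex
  have hpk : p ≤ k := Nat.find_le (by simp)
  have h3 : p < k → μ.rowLen p + (k - 1 - p) < u := fun h => by
    have : u ≠ μ.rowLen p + (k - 1 - p) := fun he =>
      hu (μ.mem_betaList_rowLens.2 ⟨p, h, he⟩)
    have h4 : ¬ u < μ.rowLen p + (k - 1 - p) := fun h5 => h2 ⟨h, h5⟩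
    omega
  have h0 : μ.rowLen k = 0 := by
    have := μ.lt_colLen_iff_lt_rowLen (i := k) (j := 0)
    omega
  have h5 : k ≤ u + p := by
    rcases hpk.lt_or_eq with h | h
    · have := h3 h; omega
    · omega
  refine ⟨u + p - k, ?_⟩
  have h6 : ¬ p < μ.colLen (u + p - k) := by
    rw [lt_colLen_iff_lt_rowLen]
    rcases hpk.lt_or_eq with h | h
    · have := h3 h; omega
    · rw [h, h0]; omega
  have h7 : p ≤ μ.colLen (u + p - k) := by
    rcases Nat.eq_zero_or_pos p with h | h
    · omega
    · have h8 := (h1 (p - 1) (by omega)).2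
      have : p - 1 < μ.colLen (u + p - k) := by
        rw [lt_colLen_iff_lt_rowLen]
        omega
      omega
  omega

/-- Hook numbers are differences between members and gaps. A member x with x - t missing gives a
hook equal to t; conversely, from a hook tm, subtracting t repeatedly would lead from a member to a
gap. -/
theorem forall_not_dvd_hookNumber_iff {t : ℕ} :
    (∀ c ∈ μ.cells, ¬ t ∣ μ.hookNumber c.1 c.2) ↔
      ∀ x ∈ betaList μ.rowLens, t ≤ x → x - t ∈ betaList μ.rowLens := by
  constructor
  · intro h x hx ht
    by_contra hn
    obtain ⟨j, hj⟩ := μ.exists_add_colLen_eq hn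
    obtain ⟨i, hi, rfl⟩ := μ.mem_betaList_rowLens.1 hx
    have hij := μ.lt_colLen_iff_lt_rowLen (i := i) (j := j)
    -- Outside the diagram the gap of column j would be larger than the hook length attached to row
    -- i.
    have hlt : j < μ.rowLen i := by
      by_contra hc
      rw [← hij] at hc
      rcases Nat.eq_zero_or_pos t with rfl | ht0
      · exact hn (by simpa using hx)
      · omega
    refine h (i, j) ((mem_cells _).2 (mem_iff_lt_rowLen.2 hlt)) ?_
    have : μ.hookNumber i j = t := by
      have := hij.2 hlt
      rw [hookNumber]
      omega
    exact this ▸ dvd_rfl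
  · rintro h ⟨i, j⟩ hc ⟨m, hm⟩
    rw [mem_cells] at hc
    have hlt := mem_iff_lt_rowLen.1 hc
    have hlt' := mem_iff_lt_colLen.1 hc
    have hk := μ.colLen_anti 0 j (Nat.zero_le _)
    have hit : ∀ m, t * m ≤ μ.rowLen i + (μ.colLen 0 - 1 - i) →
        μ.rowLen i + (μ.colLen 0 - 1 - i) - t * m ∈ betaList μ.rowLens := by
      intro m
      induction m with
      | zero => exact fun _ => μ.mem_betaList_rowLens.2 ⟨i, by omega, by simp⟩
      | succ m ih =>
        intro hle
        rw [mul_add, mul_one] at hle ⊢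
        rw [← Nat.sub_sub]
        exact h _ (ih (by omega)) (by omega)
    rw [hookNumber] at hm
    obtain ⟨i', hi', he⟩ := μ.mem_betaList_rowLens.1 (hit m (by simp only at hm; omega))
    refine μ.rowLen_add_colLen_ne (j := j) hi' ?_
    rw [← he]
    simp only at hm
    omega

end YoungDiagram

theorem Nat.Partition.isCore_iff {n t : ℕ} (p : n.Partition) : p.IsCore t ↔
    ∀ x ∈ betaList (p.parts.sort (· ≥ ·)), t ≤ x → x - t ∈ betaList (p.parts.sort (· ≥ ·)) := by
  have h : p.youngDiagram.rowLens = p.parts.sort (· ≥ ·) :=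
    YoungDiagram.rowLens_ofRowLens_eq_self fun x hx => p.parts_pos (by simpa using hx)
  rw [Nat.Partition.IsCore, YoungDiagram.forall_not_dvd_hookNumber_iff, h]

/-! ### Parametrisation of 3-cores by pairs of naturals. -/

/-- The numbers `1, 4, …, 3a - 2` and `2, 5, …, 3b - 1`. -/
def coreBetaMultiset (p : ℕ × ℕ) : Multiset ℕ :=
  (Multiset.range p.1).map (fun m => 3 * m + 1) + (Multiset.range p.2).map (fun m => 3 * m + 2)

/-- The decreasing list of first-column hook lengths of the `3`-core with parameters `(a, b)`. -/
def coreBetaList (p : ℕ × ℕ) : List ℕ := (coreBetaMultiset p).sort (· ≥ ·)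

theorem mem_coreBetaList {p : ℕ × ℕ} {x : ℕ} : x ∈ coreBetaList p ↔
    (x % 3 = 1 ∧ x / 3 < p.1) ∨ (x % 3 = 2 ∧ x / 3 < p.2) := by
  simp only [coreBetaList, coreBetaMultiset, Multiset.mem_sort, Multiset.mem_add, Multiset.mem_map,
    Multiset.mem_range]
  constructor
  · rintro (⟨m, hm, rfl⟩ | ⟨m, hm, rfl⟩) <;> omega
  · rintro (⟨h1, h2⟩ | ⟨h1, h2⟩)
    · exact Or.inl ⟨x / 3, h2, by omega⟩
    · exact Or.inr ⟨x / 3, h2, by omega⟩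

theorem nodup_coreBetaMultiset (p : ℕ × ℕ) : (coreBetaMultiset p).Nodup := by
  rw [coreBetaMultiset, Multiset.nodup_add]
  refine ⟨(Multiset.nodup_range _).map fun a b h => by simpa using h,
    (Multiset.nodup_range _).map fun a b h => by simpa using h, ?_⟩
  rw [Multiset.disjoint_left]
  simp only [Multiset.mem_map, not_exists, not_and]
  rintro x ⟨m, -, rfl⟩ m' -
  omega

theorem pairwise_coreBetaList (p : ℕ × ℕ) : (coreBetaList p).Pairwise (· > ·) := by
  have h1 := Multiset.pairwise_sort (coreBetaMultiset p) (· ≥ ·)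
  have h2 : (coreBetaList p).Nodup := by
    rw [← Multiset.coe_nodup, coreBetaList, Multiset.sort_eq]
    exact nodup_coreBetaMultiset p
  exact (h1.and h2).imp fun h => lt_of_le_of_ne h.1 (Ne.symm h.2)

theorem zero_notMem_coreBetaList (p : ℕ × ℕ) : 0 ∉ coreBetaList p := by
  simp [mem_coreBetaList]

theorem coreBetaList_injective : Function.Injective coreBetaList := by
  rintro ⟨a, b⟩ ⟨a', b'⟩ h
  have key : ∀ x, x ∈ coreBetaList (a, b) ↔ x ∈ coreBetaList (a', b') := fun x => by rw [h]
  simp only [mem_coreBetaList] at key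
  have h1 := key (3 * a + 1)
  have h2 := key (3 * a' + 1)
  have h3 := key (3 * b + 2)
  have h4 := key (3 * b' + 2)
  simp only [Prod.mk.injEq]
  omega

/-- Closure under subtracting 3 makes each residue class an initial segment, and excluding 0 empties
the class of multiples of 3. The parameters are the first missing indices in the classes 1 and 2. -/
theorem exists_coreBetaList_eq {l : List ℕ} (hl : l.Pairwise (· > ·)) (h0 : 0 ∉ l)
    (h3 : ∀ x ∈ l, 3 ≤ x → x - 3 ∈ l) : ∃ p, coreBetaList p = l := by
  classical
  have hex : ∀ r, ∃ m, 3 * m + r ∉ l := fun r => by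
    obtain ⟨y, hy⟩ := (l.toFinset : Finset ℕ).exists_nat_subset_range
    refine ⟨y, fun h => ?_⟩
    have := Finset.mem_range.1 (hy (List.mem_toFinset.2 h))
    omega
  have hdown : ∀ r m m', m ≤ m' → 3 * m' + r ∈ l → 3 * m + r ∈ l := by
    intro r m m' hm
    induction m', hm using Nat.le_induction with
    | base => exact id
    | succ m' hm ih =>
      intro h
      apply ih
      have := h3 _ h (by omega)
      rwa [show 3 * (m' + 1) + r - 3 = 3 * m' + r by omega] at this
  have hiff : ∀ r m, 3 * m + r ∈ l ↔ m < Nat.find (hex r) := fun r m => by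
    constructor
    · intro h
      by_contra hc
      exact Nat.find_spec (hex r) (hdown r _ _ (not_lt.1 hc) h)
    · intro h
      exact not_not.1 (Nat.find_min (hex r) h)
  refine ⟨(Nat.find (hex 1), Nat.find (hex 2)), ?_⟩
  refine List.Perm.eq_of_pairwise (le := (· > ·)) (fun a b _ _ h h' => by omega)
    (pairwise_coreBetaList _) hl ?_
  rw [List.perm_ext_iff_of_nodup ((pairwise_coreBetaList _).imp fun h => ne_of_gt h)
    (hl.imp fun h => ne_of_gt h)]
  intro x
  rw [mem_coreBetaList, ← hiff, ← hiff]
  have hx := Nat.div_add_mod x 3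
  obtain h | h | h : x % 3 = 0 ∨ x % 3 = 1 ∨ x % 3 = 2 := by omega
  · rw [h]
    have : x ∉ l := fun hm => h0 (hdown 0 0 (x / 3) (Nat.zero_le _) (by
      rwa [show 3 * (x / 3) + 0 = x by omega]))
    simpa using this
  · rw [h] at hx
    simp [h, hx]
  · rw [h] at hx
    simp [h, hx]

/-- The `3`-core with parameters `(a, b)`. -/
def threeCore (p : ℕ × ℕ) : Σ m : ℕ, m.Partition :=
  ⟨(unbetaList (coreBetaList p)).sum,
    { parts := unbetaList (coreBetaList p)
      parts_pos := fun {_} hi => pos_of_mem_unbetaList (pairwise_coreBetaList p)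
        (zero_notMem_coreBetaList p) _ (by simpa using hi)
      parts_sum := by simp }⟩

theorem sort_parts_threeCore (p : ℕ × ℕ) :
    (threeCore p).2.parts.sort (· ≥ ·) = unbetaList (coreBetaList p) := by
  refine List.Perm.eq_of_pairwise (le := (· ≥ ·)) (fun a b _ _ h h' => le_antisymm h' h)
    (Multiset.pairwise_sort _ _) (pairwise_unbetaList (pairwise_coreBetaList p)) ?_
  rw [← Multiset.coe_eq_coe, Multiset.sort_eq]
  rfl

theorem betaList_threeCore (p : ℕ × ℕ) :
    betaList ((threeCore p).2.parts.sort (· ≥ ·)) = coreBetaList p := by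
  rw [sort_parts_threeCore, betaList_unbetaList (pairwise_coreBetaList p)]

theorem threeCore_injective : Function.Injective threeCore := fun p q h =>
  coreBetaList_injective (by rw [← betaList_threeCore, h, betaList_threeCore])

theorem isCore_threeCore (p : ℕ × ℕ) : (threeCore p).2.IsCore 3 := by
  rw [Nat.Partition.isCore_iff, betaList_threeCore]
  simp only [mem_coreBetaList]
  intro x hx h3
  omega

theorem sigma_partition_ext {x y : Σ m : ℕ, m.Partition} (h : x.2.parts = y.2.parts) : x = y := by
  obtain ⟨m, p⟩ := x
  obtain ⟨m', p'⟩ := y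
  obtain rfl : m = m' := by rw [← p.parts_sum, ← p'.parts_sum]; exact congrArg _ h
  simp only at h
  rw [Nat.Partition.ext h]

theorem exists_threeCore_eq {x : Σ m : ℕ, m.Partition} (hx : x.2.IsCore 3) :
    ∃ p, threeCore p = x := by
  rw [Nat.Partition.isCore_iff] at hx
  have hs := Multiset.pairwise_sort x.2.parts (· ≥ ·)
  obtain ⟨p, hp⟩ := exists_coreBetaList_eq (pairwise_betaList hs)
    (zero_notMem_betaList fun y hy => x.2.parts_pos (by simpa using hy)) hx
  refine ⟨p, sigma_partition_ext ?_⟩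
  rw [← Multiset.sort_eq (threeCore p).2.parts (· ≥ ·), ← Multiset.sort_eq x.2.parts (· ≥ ·),
    sort_parts_threeCore, hp, unbetaList_betaList]

theorem two_mul_sum_map_range (r n : ℕ) :
    2 * ((((Multiset.range n).map fun m => 3 * m + r).sum : ℕ) : ℤ) =
      3 * n * (n - 1) + 2 * r * n := by
  induction n with
  | zero => simp
  | succ n ih =>
    rw [Multiset.range_succ, Multiset.map_cons, Multiset.sum_cons]
    push_cast at ih ⊢
    linarith

/-- The size is the sum of the first-column hook lengths minus the binomial coefficient (a + b
choose 2), by `sum_betaList`. -/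
theorem fst_threeCore (p : ℕ × ℕ) : (threeCore p).1 = coreSize p := by
  have h1 := sum_betaList (unbetaList (coreBetaList p))
  rw [betaList_unbetaList (pairwise_coreBetaList p), length_unbetaList] at h1
  have h2 : (coreBetaList p).sum = (coreBetaMultiset p).sum := by
    rw [← Multiset.sum_coe, coreBetaList, Multiset.sort_eq]
  have h3 : (coreBetaList p).length = p.1 + p.2 := by
    simp [coreBetaList, coreBetaMultiset]
  rw [h2, h3, coreBetaMultiset, Multiset.sum_add] at h1
  have h4 := two_mul_sum_map_range 1 p.1
  have h5 := two_mul_sum_map_range 2 p.2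
  have h6 := two_mul_choose_two (p.1 + p.2)
  have h7 := two_mul_eisensteinExp ((p.2 : ℤ) - p.1, (p.1 : ℤ))
  rw [coreSize, threeCore]
  zify at h1 ⊢
  push_cast at *
  linarith

theorem numCoreTriples_three (n : ℕ) :
    (numCoreTriples 3 n : ℚ) = coeff n (powSum coreSize ^ 3) := by
  have hf := finiteSublevels_coreSize
  rw [pow_succ, pow_two, hf.powSum_mul hf, (hf.add hf).powSum_mul hf,
    ((hf.add hf).add hf).coeff_powSum, numCoreTriples]
  congr 1
  have hinj : Function.Injective fun q : ((ℕ × ℕ) × ℕ × ℕ) × ℕ × ℕ =>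
      ![threeCore q.1.1, threeCore q.1.2, threeCore q.2] := by
    rintro ⟨⟨p, q⟩, r⟩ ⟨⟨p', q'⟩, r'⟩ h
    have h0 := threeCore_injective (congrFun h 0)
    have h1 := threeCore_injective (congrFun h 1)
    have h2 := threeCore_injective (congrFun h 2)
    simp only at h0 h1 h2
    rw [h0, h1, h2]
  rw [← Set.ncard_image_of_injective _ hinj]
  congr 1
  ext l
  simp only [coreTriples, Set.mem_ofPred_eq, Set.mem_image, Prod.exists]
  constructor
  · rintro ⟨hc, hs⟩
    obtain ⟨p, hp⟩ := exists_threeCore_eq (hc 0)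
    obtain ⟨q, hq⟩ := exists_threeCore_eq (hc 1)
    obtain ⟨r, hr⟩ := exists_threeCore_eq (hc 2)
    refine ⟨p.1, p.2, q.1, q.2, r.1, r.2, ?_, ?_⟩
    · rw [← hs, Fin.sum_univ_three, ← hp, ← hq, ← hr, fst_threeCore, fst_threeCore, fst_threeCore]
    · ext i : 1
      fin_cases i
      · exact hp
      · exact hq
      · exact hr
  · rintro ⟨a, b, c, d, e, f, hs, rfl⟩
    refine ⟨fun i => ?_, ?_⟩
    · fin_cases i <;> exact isCore_threeCore _
    · rw [Fin.sum_univ_three, ← hs]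
      simp [fst_threeCore]

/-! ### Dissection of the cube of the core series. -/

theorem coeff_two_mul_dissection (f g : ℚ⟦X⟧) (n : ℕ) :
    coeff (2 * n) (expand 2 two_ne_zero f + X * expand 2 two_ne_zero g) = coeff n f := by
  rw [map_add, coeff_expand_mul]
  rcases n with _ | n
  · simp
  · rw [mul_add, mul_one, coeff_succ_X_mul, coeff_expand_of_not_dvd _ _ _ (by omega), add_zero]

theorem coeff_three_mul_dissection (f g h : ℚ⟦X⟧) (n : ℕ) :
    coeff (3 * n) (expand 3 three_ne_zero f + X * expand 3 three_ne_zero g +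
      X ^ 2 * expand 3 three_ne_zero h) = coeff n f := by
  rw [pow_two, mul_assoc, map_add, map_add, coeff_expand_mul]
  rcases n with _ | n
  · simp
  · rw [mul_add, mul_one, coeff_succ_X_mul, coeff_succ_X_mul, coeff_succ_X_mul,
      coeff_expand_of_not_dvd _ _ _ (by omega), coeff_expand_of_not_dvd _ _ _ (by omega)]
    simp

theorem coeff_three_mul_add_two_dissection (f g h : ℚ⟦X⟧) (n : ℕ) :
    coeff (3 * n + 2) (expand 3 three_ne_zero f + X * expand 3 three_ne_zero g +
      X ^ 2 * expand 3 three_ne_zero h) = coeff n h := by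
  rw [pow_two, mul_assoc, map_add, map_add, coeff_succ_X_mul, coeff_succ_X_mul, coeff_succ_X_mul,
    coeff_expand_mul, coeff_expand_of_not_dvd _ _ _ (by omega),
    coeff_expand_of_not_dvd _ _ _ (by omega)]
  simp

/-- The cube of A(q²) + qB(q²) is expanded and only the even powers are kept. -/
theorem coeff_two_mul_powSum_coreSize_pow_three (n : ℕ) :
    coeff (2 * n) (powSum coreSize ^ 3) = coeff n ((psiSeries * pentSeries) ^ 3 +
      3 * X * (psiSeries * pentSeries) * expand 2 two_ne_zero (powSum coreSize) ^ 2) := by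
  have h4 : expand 4 four_ne_zero (powSum coreSize) =
      expand 2 two_ne_zero (expand 2 two_ne_zero (powSum coreSize)) :=
    expand_mul 2 two_ne_zero 2 two_ne_zero _
  have h := powSum_coreSize_eq
  rw [h4] at h
  set B := expand 2 two_ne_zero (powSum coreSize)
  set A := psiSeries * pentSeries
  rw [← coeff_two_mul_dissection (A ^ 3 + 3 * X * A * B ^ 2)
    (3 * A ^ 2 * B + X * B ^ 3), h]
  refine congrArg _ ?_
  simp only [map_add, map_mul, map_pow, map_ofNat, expand_X]
  ring

/-- The fraction field of the ring of rational power series. -/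
abbrev PowerSeriesField : Type := FractionRing ℚ⟦X⟧

/-- The inclusion of the power series into their fraction field. -/
noncomputable def toField : ℚ⟦X⟧ →+* PowerSeriesField := algebraMap _ _

theorem toField_injective : Function.Injective toField := IsFractionRing.injective _ _

theorem toField_eulerF_ne_zero {k : ℕ} (hk : 0 < k) : toField (eulerF k) ≠ 0 :=
  fun h => (isUnit_eulerF hk).ne_zero (toField_injective (by rw [h, map_zero]))

theorem toField_inv {f : ℚ⟦X⟧} (hf : constantCoeff f ≠ 0) : toField f⁻¹ = (toField f)⁻¹ := by
  apply eq_inv_of_mul_eq_one_right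
  rw [← map_mul, PowerSeries.mul_inv_cancel f hf, map_one]

theorem toField_psiSeries :
    toField psiSeries = toField (eulerF 2) ^ 2 / toField (eulerF 1) := by
  rw [eq_div_iff (toField_eulerF_ne_zero one_pos), ← map_mul, psiSeries_mul, map_pow]

theorem toField_pentSeries : toField pentSeries =
    toField (eulerF 2) * toField (eulerF 3) ^ 2 / (toField (eulerF 1) * toField (eulerF 6)) := by
  rw [eq_div_iff (mul_ne_zero (toField_eulerF_ne_zero one_pos)
    (toField_eulerF_ne_zero (by norm_num))), ← map_mul, ← map_mul, pentSeries_mul, map_mul, map_pow]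

theorem toField_omegaSeries : toField omegaSeries =
    toField (eulerF 1) * toField (eulerF 6) ^ 2 / (toField (eulerF 2) * toField (eulerF 3)) := by
  rw [eq_div_iff (mul_ne_zero (toField_eulerF_ne_zero two_pos)
    (toField_eulerF_ne_zero three_pos)), ← map_mul, ← map_mul, omegaSeries_mul, map_mul, map_pow]

theorem toField_phiSeries :
    toField phiSeries = toField (eulerF 1) ^ 2 / toField (eulerF 2) := by
  rw [eq_div_iff (toField_eulerF_ne_zero two_pos), ← map_mul, phiSeries_mul, map_pow]

theorem toField_expand_psiSeries : toField (expand 3 three_ne_zero psiSeries) =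
    toField (eulerF 6) ^ 2 / toField (eulerF 3) := by
  have h := congrArg (expand 3 three_ne_zero) psiSeries_mul
  simp only [map_mul, map_pow, expand_eulerF three_ne_zero (Nat.succ_pos _)] at h
  rw [eq_div_iff (toField_eulerF_ne_zero three_pos), ← map_mul, ← map_pow]
  exact congrArg _ h

theorem toField_expand_phiSeries : toField (expand 3 three_ne_zero phiSeries) =
    toField (eulerF 3) ^ 2 / toField (eulerF 6) := by
  have h := congrArg (expand 3 three_ne_zero) phiSeries_mul
  simp only [map_mul, map_pow, expand_eulerF three_ne_zero (Nat.succ_pos _)] at h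
  rw [eq_div_iff (toField_eulerF_ne_zero (by norm_num)), ← map_mul, ← map_pow]
  exact congrArg _ h

theorem toField_expand_powSum_coreSize : toField (expand 2 two_ne_zero (powSum coreSize)) =
    toField (eulerF 6) ^ 3 / toField (eulerF 2) := by
  have h := congrArg (expand 2 two_ne_zero) powSum_coreSize_mul_eulerF
  simp only [map_mul, map_pow, expand_eulerF two_ne_zero (Nat.succ_pos _)] at h
  rw [eq_div_iff (toField_eulerF_ne_zero two_pos), ← map_mul, ← map_pow]
  exact congrArg _ h

/-- The coefficient `f₁⁶ / f₂³` in the dissection. -/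
noncomputable def dissectionCoeff₁ : ℚ⟦X⟧ := eulerF 1 ^ 6 * (eulerF 2 ^ 3)⁻¹

/-- The coefficient `f₁² f₂⁵` in the dissection. -/
noncomputable def dissectionCoeff₂ : ℚ⟦X⟧ := eulerF 1 ^ 2 * eulerF 2 ^ 5

/-- The inverse `f₂⁴ f₃² / (f₁⁸ f₆)` of the norm of `phiSeries`. -/
noncomputable def phiNormInv : ℚ⟦X⟧ :=
  eulerF 2 ^ 4 * eulerF 3 ^ 2 * (eulerF 1 ^ 8 * eulerF 6)⁻¹

theorem constantCoeff_eulerF_ne_zero {k : ℕ} (hk : 0 < k) : constantCoeff (eulerF k) ≠ 0 := by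
  rw [constantCoeff_eulerF hk]; exact one_ne_zero

theorem phiNormInv_mul :
    phiNormInv * (expand 3 three_ne_zero phiSeries ^ 3 - 8 * X * omegaSeries ^ 3) = 1 := by
  have h : constantCoeff (eulerF 1 ^ 8 * eulerF 6) ≠ 0 := by
    simp [constantCoeff_eulerF_ne_zero]
  have h2 := PowerSeries.mul_inv_cancel _ h
  rw [phiNormInv]
  linear_combination (eulerF 1 ^ 8 * eulerF 6)⁻¹ * phi_cubic_relation + h2

/-- Multiplying by `phiSeries` cancels its denominators down to c₁(X³)ψ⁴ + 3X c₂(X³). With P and W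
the components of φ = P - 2XW, the factor P² + 2XPW + 4X²W² completes φ to P³ - 8X³W³, whose inverse
is a series in X³. -/
theorem coreSeries_even_eq : (psiSeries * pentSeries) ^ 3 +
      3 * X * (psiSeries * pentSeries) * expand 2 two_ne_zero (powSum coreSize) ^ 2 =
    expand 3 three_ne_zero phiNormInv *
      (expand 3 three_ne_zero (expand 3 three_ne_zero phiSeries) ^ 2 +
        2 * X * expand 3 three_ne_zero (expand 3 three_ne_zero phiSeries) *
          expand 3 three_ne_zero omegaSeries +
        4 * X ^ 2 * expand 3 three_ne_zero omegaSeries ^ 2) *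
      (expand 3 three_ne_zero dissectionCoeff₁ *
        (expand 3 three_ne_zero pentSeries +
          X * expand 3 three_ne_zero (expand 3 three_ne_zero psiSeries)) ^ 4 +
        3 * X * expand 3 three_ne_zero dissectionCoeff₂) := by
  have e1 := toField_eulerF_ne_zero one_pos
  have e2 := toField_eulerF_ne_zero two_pos
  have e3 := toField_eulerF_ne_zero three_pos
  have e6 := toField_eulerF_ne_zero (k := 6) (by norm_num)
  have hphi0 : phiSeries ≠ 0 := fun h => by
    have := phiSeries_mul
    rw [h, zero_mul] at this
    exact pow_ne_zero 2 (isUnit_eulerF one_pos).ne_zero this.symm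
  apply mul_left_cancel₀ hphi0
  have hN := congrArg (expand 3 three_ne_zero) phiNormInv_mul
  simp only [map_mul, map_sub, map_pow, map_ofNat, expand_X, map_one] at hN
  have hc : expand 3 three_ne_zero dissectionCoeff₁ * eulerF 6 ^ 3 = eulerF 3 ^ 6 := by
    have h : constantCoeff (eulerF 2 ^ 3) ≠ 0 := by simp [constantCoeff_eulerF_ne_zero]
    have h2 : dissectionCoeff₁ * eulerF 2 ^ 3 = eulerF 1 ^ 6 := by
      rw [dissectionCoeff₁, mul_assoc, PowerSeries.inv_mul_cancel _ h, mul_one]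
    have h3 := congrArg (expand 3 three_ne_zero) h2
    simpa only [map_mul, map_pow, expand_eulerF three_ne_zero (Nat.succ_pos _)] using h3
  have hc2 : expand 3 three_ne_zero dissectionCoeff₂ = eulerF 3 ^ 2 * eulerF 6 ^ 5 := by
    simp only [dissectionCoeff₂, map_mul, map_pow, expand_eulerF three_ne_zero (Nat.succ_pos _)]
  have hφ := phiSeries_eq
  simp only [map_mul, map_neg, map_ofNat] at hφ
  rw [← psiSeries_eq, hc2]
  trans (expand 3 three_ne_zero dissectionCoeff₁ * psiSeries ^ 4 +
    3 * X * (eulerF 3 ^ 2 * eulerF 6 ^ 5))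
  · have hc' : toField (expand 3 three_ne_zero dissectionCoeff₁) =
        toField (eulerF 3) ^ 6 / toField (eulerF 6) ^ 3 := by
      rw [eq_div_iff (pow_ne_zero _ e6), ← map_pow, ← map_mul, hc, map_pow]
    apply toField_injective
    simp only [map_mul, map_add, map_pow, map_ofNat, hc', toField_psiSeries, toField_pentSeries,
      toField_phiSeries, toField_expand_powSum_coreSize]
    field_simp
  · set P := expand 3 three_ne_zero (expand 3 three_ne_zero phiSeries)
    set W := expand 3 three_ne_zero omegaSeries
    set S := expand 3 three_ne_zero dissectionCoeff₁ * psiSeries ^ 4 +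
      3 * X * (eulerF 3 ^ 2 * eulerF 6 ^ 5)
    set M := expand 3 three_ne_zero phiNormInv
    linear_combination -S * hN - M * (P ^ 2 + 2 * X * P * W + 4 * X ^ 2 * W ^ 2) * S * hφ

theorem coreSeries_even_dissection : ∃ g, (psiSeries * pentSeries) ^ 3 +
      3 * X * (psiSeries * pentSeries) * expand 2 two_ne_zero (powSum coreSize) ^ 2 =
    expand 3 three_ne_zero ((eulerF 2 ^ 10 * eulerF 3 ^ 9) * (eulerF 1 ^ 7 * eulerF 6 ^ 6)⁻¹
        + 16 * X * ((eulerF 2 ^ 7 * eulerF 6 ^ 3) * (eulerF 1 ^ 4)⁻¹)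
        + 27 * X * ((eulerF 2 ^ 2 * eulerF 3 ^ 5 * eulerF 6 ^ 2) * (eulerF 1 ^ 3)⁻¹)) +
      X * expand 3 three_ne_zero g +
      X ^ 2 * expand 3 three_ne_zero (24 * ((eulerF 2 ^ 8 * eulerF 3 ^ 3) * (eulerF 1 ^ 5)⁻¹)) := by
  have e1 := toField_eulerF_ne_zero one_pos
  have e2 := toField_eulerF_ne_zero two_pos
  have e3 := toField_eulerF_ne_zero three_pos
  have e6 := toField_eulerF_ne_zero (k := 6) (by norm_num)
  have hc1 : toField dissectionCoeff₁ = toField (eulerF 1) ^ 6 / toField (eulerF 2) ^ 3 := by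
    rw [dissectionCoeff₁, map_mul, toField_inv (by simp [constantCoeff_eulerF_ne_zero]), map_pow,
      map_pow, div_eq_mul_inv]
  have hM : toField phiNormInv = toField (eulerF 2) ^ 4 * toField (eulerF 3) ^ 2 /
      (toField (eulerF 1) ^ 8 * toField (eulerF 6)) := by
    rw [phiNormInv, map_mul, toField_inv (by simp [constantCoeff_eulerF_ne_zero])]
    simp only [map_mul, map_pow, div_eq_mul_inv]
  have hR := congrArg toField psi_cubic_relation
  simp only [map_mul, map_add, map_pow, toField_pentSeries, toField_expand_psiSeries] at hR
  set φ := expand 3 three_ne_zero phiSeries with hφ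
  set ψ := expand 3 three_ne_zero psiSeries with hψ
  have h0 : (eulerF 2 ^ 10 * eulerF 3 ^ 9) * (eulerF 1 ^ 7 * eulerF 6 ^ 6)⁻¹
        + 16 * X * ((eulerF 2 ^ 7 * eulerF 6 ^ 3) * (eulerF 1 ^ 4)⁻¹)
        + 27 * X * ((eulerF 2 ^ 2 * eulerF 3 ^ 5 * eulerF 6 ^ 2) * (eulerF 1 ^ 3)⁻¹) =
      phiNormInv * (dissectionCoeff₁ * (φ ^ 2 * (pentSeries ^ 4 + 4 * X * pentSeries * ψ ^ 3) +
        12 * X * φ * omegaSeries * pentSeries ^ 2 * ψ ^ 2 +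
        4 * X * omegaSeries ^ 2 * (4 * pentSeries ^ 3 * ψ + X * ψ ^ 4)) +
        12 * X * dissectionCoeff₂ * omegaSeries ^ 2) := by
    apply toField_injective
    simp only [map_mul, map_add, map_pow, map_ofNat, hc1, hM, dissectionCoeff₂, hφ, hψ,
      toField_pentSeries, toField_omegaSeries, toField_expand_psiSeries, toField_expand_phiSeries]
    rw [toField_inv (by simp [constantCoeff_eulerF_ne_zero]),
      toField_inv (by simp [constantCoeff_eulerF_ne_zero]),
      toField_inv (by simp [constantCoeff_eulerF_ne_zero])]
    simp only [map_mul, map_pow]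
    generalize toField (eulerF 1) = a at *
    generalize toField (eulerF 2) = b at *
    generalize toField (eulerF 3) = c at *
    generalize toField (eulerF 6) = d at *
    generalize toField X = x at *
    -- The cubic relation for ψ divided by the cube of the pentagonal series.
    have hR' : 1 + x * (a ^ 3 * d ^ 9) / (b ^ 3 * c ^ 9) - b ^ 5 * d / (a * c ^ 5) = 0 := by
      field_simp at hR ⊢
      linear_combination hR
    rw [← sub_eq_zero, ← neg_eq_zero]
    -- The two sides are not equal as rational functions of a, b, c, d, x: they differ by this
    -- cofactor times the cubic relation.
    trans b ^ 5 * c ^ 14 / (a ^ 6 * d ^ 7) * (1 + 4 * (x * (a ^ 3 * d ^ 9) / (b ^ 3 * c ^ 9))) *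
      (1 + x * (a ^ 3 * d ^ 9) / (b ^ 3 * c ^ 9) - b ^ 5 * d / (a * c ^ 5))
    · field_simp
      ring
    · rw [hR', mul_zero]
  have h2 : 24 * ((eulerF 2 ^ 8 * eulerF 3 ^ 3) * (eulerF 1 ^ 5)⁻¹) =
      phiNormInv * (dissectionCoeff₁ * (6 * φ ^ 2 * pentSeries ^ 2 * ψ ^ 2 +
        2 * φ * omegaSeries * (4 * pentSeries ^ 3 * ψ + X * ψ ^ 4) +
        4 * omegaSeries ^ 2 * (pentSeries ^ 4 + 4 * X * pentSeries * ψ ^ 3)) +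
        6 * dissectionCoeff₂ * φ * omegaSeries) := by
    apply toField_injective
    simp only [map_mul, map_add, map_pow, map_ofNat, hc1, hM, dissectionCoeff₂, hφ, hψ,
      toField_pentSeries, toField_omegaSeries, toField_expand_psiSeries, toField_expand_phiSeries]
    rw [toField_inv (by simp [constantCoeff_eulerF_ne_zero])]
    simp only [map_pow]
    generalize toField (eulerF 1) = a at *
    generalize toField (eulerF 2) = b at *
    generalize toField (eulerF 3) = c at *
    generalize toField (eulerF 6) = d at *
    generalize toField X = x at *
    have hR' : 1 + x * (a ^ 3 * d ^ 9) / (b ^ 3 * c ^ 9) - b ^ 5 * d / (a * c ^ 5) = 0 := by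
      field_simp at hR ⊢
      linear_combination hR
    rw [← sub_eq_zero, ← neg_eq_zero]
    trans b ^ 3 * c ^ 8 / (a ^ 4 * d) * 18 *
      (1 + x * (a ^ 3 * d ^ 9) / (b ^ 3 * c ^ 9) - b ^ 5 * d / (a * c ^ 5))
    · field_simp
      ring
    · rw [hR', mul_zero]
  rw [h0, h2, coreSeries_even_eq]
  -- The witness collects the terms with exponent 1 mod 3, whose closed form is not needed.
  refine ⟨phiNormInv * (dissectionCoeff₁ * (φ ^ 2 * (4 * pentSeries ^ 3 * ψ + X * ψ ^ 4) +
    2 * φ * omegaSeries * (pentSeries ^ 4 + 4 * X * pentSeries * ψ ^ 3) +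
    24 * X * omegaSeries ^ 2 * pentSeries ^ 2 * ψ ^ 2) + 3 * dissectionCoeff₂ * φ ^ 2), ?_⟩
  simp only [map_mul, map_add, map_pow, map_ofNat, expand_X]
  ring

/-! ### Integrality and conclusion. -/

/-- The coefficient of X^d is already that of a finite product with integer coefficients.
Integrality is what makes the factor 24 yield a congruence. -/
theorem exists_map_eq_eulerF {k : ℕ} (hk : 0 < k) :
    ∃ g : ℤ⟦X⟧, PowerSeries.map (Int.castRingHom ℚ) g = eulerF k := by
  refine ⟨PowerSeries.mk fun d => coeff d (qFactor (X ^ k : ℤ⟦X⟧) (d + 1)), ?_⟩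
  have hq : ∀ n, PowerSeries.map (Int.castRingHom ℚ) (qFactor (X ^ k : ℤ⟦X⟧) n) =
      qFactor (X ^ k) n := fun n => by simp [qFactor, map_prod]
  ext d
  rw [coeff_map, coeff_mk, ← coeff_map, hq]
  have := X_pow_dvd_iff.1 (X_pow_dvd_eulerF_sub (k := d + 1) hk le_rfl) d d.lt_succ_self
  rw [map_sub, sub_eq_zero] at this
  exact this.symm

theorem exists_map_eq_inv {f : ℚ⟦X⟧} (hf : ∃ g : ℤ⟦X⟧, PowerSeries.map (Int.castRingHom ℚ) g = f)
    (h1 : constantCoeff f = 1) : ∃ g : ℤ⟦X⟧, PowerSeries.map (Int.castRingHom ℚ) g = f⁻¹ := by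
  obtain ⟨g, rfl⟩ := hf
  have hg : constantCoeff g = ((1 : ℤˣ) : ℤ) := by
    rw [← coeff_zero_eq_constantCoeff_apply, coeff_map, coeff_zero_eq_constantCoeff_apply] at h1
    simpa using h1
  refine ⟨invOfUnit g 1, ?_⟩
  rw [PowerSeries.eq_inv_iff_mul_eq_one (by rw [h1]; exact one_ne_zero), ← map_mul,
    PowerSeries.invOfUnit_mul _ _ hg, map_one]

theorem mainTheorem6 :
    PowerSeries.mk (fun n : ℕ => (numCoreTriples 3 (6 * n) : ℚ)) =
        (eulerF 2 ^ 10 * eulerF 3 ^ 9) * (eulerF 1 ^ 7 * eulerF 6 ^ 6)⁻¹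
          + 16 * X * ((eulerF 2 ^ 7 * eulerF 6 ^ 3) * (eulerF 1 ^ 4)⁻¹)
          + 27 * X * ((eulerF 2 ^ 2 * eulerF 3 ^ 5 * eulerF 6 ^ 2) * (eulerF 1 ^ 3)⁻¹) ∧
      PowerSeries.mk (fun n : ℕ => (numCoreTriples 3 (6 * n + 4) : ℚ)) =
        24 * ((eulerF 2 ^ 8 * eulerF 3 ^ 3) * (eulerF 1 ^ 5)⁻¹) ∧
      ∀ n : ℕ, numCoreTriples 3 (6 * n + 4) ≡ 0 [MOD 24] := by
  obtain ⟨g, hg⟩ := coreSeries_even_dissection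
  have h4 : PowerSeries.mk (fun n : ℕ => (numCoreTriples 3 (6 * n + 4) : ℚ)) =
      24 * ((eulerF 2 ^ 8 * eulerF 3 ^ 3) * (eulerF 1 ^ 5)⁻¹) := by
    ext n
    -- The index 6n + 4 is the even index 2m with m = 3n + 2, so it is read off the X² part of the
    -- 3-dissection.
    rw [coeff_mk, numCoreTriples_three, show 6 * n + 4 = 2 * (3 * n + 2) by ring,
      coeff_two_mul_powSum_coreSize_pow_three, hg, coeff_three_mul_add_two_dissection]
  refine ⟨?_, h4, fun n => ?_⟩
  · ext n
    rw [coeff_mk, numCoreTriples_three, show 6 * n = 2 * (3 * n) by ring,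
      coeff_two_mul_powSum_coreSize_pow_three, hg, coeff_three_mul_dissection]
  · obtain ⟨a, ha⟩ := exists_map_eq_eulerF one_pos
    obtain ⟨b, hb⟩ := exists_map_eq_eulerF two_pos
    obtain ⟨c, hc⟩ := exists_map_eq_eulerF three_pos
    obtain ⟨d, hd⟩ := exists_map_eq_inv (f := eulerF 1 ^ 5) ⟨a ^ 5, by rw [map_pow, ha]⟩
      (by rw [map_pow, constantCoeff_eulerF one_pos, one_pow])
    have h := congrArg (coeff n) h4
    have e : 24 * ((eulerF 2 ^ 8 * eulerF 3 ^ 3) * (eulerF 1 ^ 5)⁻¹) =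
        PowerSeries.map (Int.castRingHom ℚ) (C 24 * (b ^ 8 * c ^ 3 * d)) := by
      simp only [map_mul, map_pow, map_ofNat, hb, hc, hd]
    rw [coeff_mk, e, coeff_map, coeff_C_mul, eq_intCast] at h
    have h' : (numCoreTriples 3 (6 * n + 4) : ℤ) = 24 * coeff n (b ^ 8 * c ^ 3 * d) := by
      exact_mod_cast h
    rw [Nat.modEq_zero_iff_dvd]
    exact Int.natCast_dvd_natCast.1 ⟨_, h'⟩
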